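/- **Notation.** $\mathbb H$ is the skew field of real quaternions and $\mathbf B^*$ is the conjugate transpose of $\mathbf B$. $\mathbb H^{m\times n}_r$ is the set of $m\times n$ quaternion matrices of rank $r$, the rank $\operatorname{rk}$ being the dimension of the left row space (equivalently, of the right column space). For a square matrix $\mathbf B$, $\operatorname{Ind}\mathbf B$ is the smallest positive integer $k$ with $\operatorname{rk}\mathbf B^{k+1}=\operatorname{rk}\mathbf B^{k}$. Write $\mathbf b_{i.}$ for the $i$-th row and $\mathbf b_{.j}$ for the $j$-th column of $\mathbf B$. *Row and column determinants.* For $\mathbf B=(b_{ij})\in\mathbb H^{N\times N}$, $\sigma\in S_N$ and $s\in\{1,\dots,N\}$ let $c_\sigma(s)=b_{s\,\sigma(s)}\,b_{\sigma(s)\,\sigma^2(s)}\cdots b_{\sigma^{l}(s)\,s}$, where $l+1$ is the length of the cycle of $\sigma$ through $s$. Let $\rho(\sigma)$ be the number of cycles of $\sigma$ (fixed points included), and let $s_2<\dots<s_{\rho(\sigma)}$ be the least elements of the cycles of $\sigma$ not containing $i$. Then $$\operatorname{rdet}_i\mathbf B=\sum_{\sigma\in S_N}(-1)^{N-\rho(\sigma)}\,c_\sigma(i)\,c_\sigma(s_2)\cdots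 c_\sigma(s_{\rho(\sigma)}),\qquad \operatorname{cdet}_i\mathbf B=\sum_{\sigma\in S_N}(-1)^{N-\rho(\sigma)}\,c_\sigma(s_{\rho(\sigma)})\cdots c_\sigma(s_2)\,c_\sigma(i).$$ For a Hermitian matrix $\mathbf B$ all $\operatorname{rdet}_i\mathbf B$ and $\operatorname{cdet}_i\mathbf B$ coincide and are real; the common value is $|\mathbf B|$, and the determinant of the empty matrix is $1$. *Sums of minors.* $\mathbf B_\alpha^\alpha$ is the principal submatrix of $\mathbf B\in\mathbb H^{N\times N}$ with rows and columns in $\alpha\subseteq\{1,\dots,N\}$; its rows and columns keep their labels from $\alpha$. $I_{q,N}=J_{q,N}$ is the set of $q$-element subsets of $\{1,\dots,N\}$, and $I_{q,N}\{j\}=J_{q,N}\{j\}$ is the set of those that contain $j$ (an empty sum is $0$). $\mathbf B_{j.}(\mathbf b)$ is $\mathbf B$ with its $j$-th row replaced by $\mathbf b$, and $\mathbf B_{.i}(\mathbf c)$ is $\mathbf B$ with its $i$-th column replaced by $\mathbf c$. Put $$R^{q}_{j}(\mathbf B;\mathbf b)=\sum_{\alpha\in I_{q,N}\{j\}}\operatorname{rdet}_j\big(\mathbf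 B_{j.}(\mathbf b)\big)_\alpha^\alpha,\qquad C^{q}_{i}(\mathbf B;\mathbf c)=\sum_{\beta\in J_{q,N}\{i\}}\operatorname{cdet}_i\big(\mathbf B_{.i}(\mathbf c)\big)_\beta^\beta,$$ and, for Hermitian $\mathbf B$, $d_q(\mathbf B)=\sum_{\alpha\in I_{q,N}}|\mathbf B_\alpha^\alpha|$. *Generalized inverses.* $\mathbf A^\dagger$ is the Moore–Penrose inverse of $\mathbf A$, i.e. the unique $\mathbf X$ with $\mathbf{AXA}=\mathbf A$, $\mathbf{XAX}=\mathbf X$, $(\mathbf{AX})^*=\mathbf{AX}$, $(\mathbf{XA})^*=\mathbf{XA}$. For $\mathbf A\in\mathbb H^{m\times n}$ and $\mathbf W\in\mathbb H^{n\times m}$, the $\mathbf W$-weighted Drazin inverse $\mathbf A^{d,W}$ is the unique $\mathbf X\in\mathbb H^{m\times n}$ with $(\mathbf{AW})^{p+1}\mathbf{XW}=(\mathbf{AW})^{p}$ for $p=\operatorname{Ind}(\mathbf{AW})$, $\mathbf{XWAWX}=\mathbf X$ and $\mathbf{AWX}=\mathbf{XWA}$. The weighted CMP inverse is $$\mathbf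 A^{c,\dagger,W}=\mathbf A^\dagger\mathbf A\mathbf W\mathbf A^{d,W}\mathbf W\mathbf A\mathbf A^\dagger .$$ **Theorem 5.3.** Let $\mathbf A\in\mathbb H^{m\times n}_r$, let $\mathbf W\in\mathbb H^{n\times m}$ be nonzero, and put $\mathbf U=\mathbf{WA}$, $\mathbf V=\mathbf{AW}$, $k=\max\{\operatorname{Ind}\mathbf U,\operatorname{Ind}\mathbf V\}$. Then the entries of $\mathbf A^{c,\dagger,W}=(a^{c,\dagger,W}_{ij})\in\mathbb H^{n\times m}$ have the following representations. (i) If $\operatorname{rk}\mathbf U^k=r_1$, then for all $i=1,\dots,n$ and $j=1,\dots,m$ $$a^{c,\dagger,W}_{ij}=\frac{R^{r}_{j}\big(\mathbf{AA}^*;\widetilde{\boldsymbol\omega}_{i.}\big)}{\big(d_r(\mathbf A^*\mathbf A)\big)^2\,\big(d_{r_1}(\mathbf G)\big)^2},\qquad \mathbf G=\mathbf U^{2k+1}(\mathbf U^{2k+1})^*,$$ where $\widetilde{\boldsymbol\omega}_{i.}$ is the $i$-th row of $\widetilde{\boldsymbol\Omega}=\boldsymbol\Omega(\mathbf{WA})^{k+1}\mathbf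 A^*$ and - $\boldsymbol\Omega=(\omega_{iz})\in\mathbb H^{n\times n}$, $\omega_{iz}=C^{r}_{i}(\mathbf A^*\mathbf A;\boldsymbol\phi^{(1)}_{.z})$, with $\boldsymbol\phi^{(1)}_{.z}$ the $z$-th column of $\boldsymbol\Phi_1=\mathbf A^*\mathbf{AW}\widehat{\boldsymbol\Phi}$; - $\widehat{\boldsymbol\Phi}=(\widehat\phi_{tz})\in\mathbb H^{m\times n}$, $\widehat\phi_{tz}=R^{r_1}_{z}(\mathbf G;\widetilde{\boldsymbol\phi}_{t.})$, with $\widetilde{\boldsymbol\phi}_{t.}$ the $t$-th row of $\widetilde{\boldsymbol\Phi}=\mathbf A\boldsymbol\Phi\mathbf U^{2k}(\mathbf U^{2k+1})^*$; - $\boldsymbol\Phi=(\phi_{lq})\in\mathbb H^{n\times n}$, $\phi_{lq}=R^{r_1}_{q}(\mathbf G;\check{\mathbf u}_{l.})$, with $\check{\mathbf u}_{l.}$ the $l$-th row of $\check{\mathbf U}=\mathbf U^{k}(\mathbf U^{2k+1})^*$. (ii) If $\operatorname{rk}\mathbf V^k=r_1$, then for all $i=1,\dots,n$ and $j=1,\dots,m$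 $$a^{c,\dagger,W}_{ij}=\frac{C^{r}_{i}\big(\mathbf A^*\mathbf A;\widetilde{\boldsymbol\upsilon}_{.j}\big)}{\big(d_r(\mathbf{AA}^*)\big)^2\,\big(d_{r_1}(\mathbf H)\big)^2},\qquad \mathbf H=(\mathbf V^{2k+1})^*\mathbf V^{2k+1},$$ where $\widetilde{\boldsymbol\upsilon}_{.j}$ is the $j$-th column of $\widetilde{\boldsymbol\Upsilon}=\mathbf A^*(\mathbf{AW})^{k+1}\boldsymbol\Upsilon$ and - $\boldsymbol\Upsilon=(\upsilon_{zj})\in\mathbb H^{m\times m}$, $\upsilon_{zj}=R^{r}_{j}(\mathbf{AA}^*;\boldsymbol\psi^{(1)}_{z.})$, with $\boldsymbol\psi^{(1)}_{z.}$ the $z$-th row of $\boldsymbol\Psi^{(1)}=\widehat{\boldsymbol\Psi}\mathbf{WAA}^*$; - $\widehat{\boldsymbol\Psi}=(\widehat\psi_{zs})\in\mathbb H^{m\times n}$, $\widehat\psi_{zs}=C^{r_1}_{z}(\mathbf H;\widetilde{\boldsymbol\psi}_{.s})$, with $\widetilde{\boldsymbol\psi}_{.s}$ the $s$-th column of $\widetilde{\boldsymbol\Psi}=(\mathbf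 V^{2k+1})^*\mathbf V^{2k}\boldsymbol\Psi\mathbf A$; - $\boldsymbol\Psi=(\psi_{lt})\in\mathbb H^{m\times m}$, $\psi_{lt}=C^{r_1}_{l}(\mathbf H;\hat{\mathbf v}_{.t})$, with $\hat{\mathbf v}_{.t}$ the $t$-th column of $\hat{\mathbf V}=(\mathbf V^{2k+1})^*\mathbf V^{k}$. -/

import Mathlib

open scoped Quaternion Matrix

namespace QuatMat

/-! ### Rank and index of quaternion matrices -/

section Rank

/-- The rank of a quaternion matrix: the dimension of its left row space, i.e. of the left
`ℍ`-vector space spanned by its rows. (It equals the dimension of the right column space.) -/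
noncomputable def rk {ι κ : Type*} (A : Matrix ι κ ℍ[ℝ]) : ℕ :=
  Module.finrank ℍ[ℝ] (Submodule.span ℍ[ℝ] (Set.range A.row))

/-- The index of a square quaternion matrix: the smallest positive `k` with
`rk (A ^ (k + 1)) = rk (A ^ k)`. -/
noncomputable def ind {ι : Type*} [Fintype ι] [DecidableEq ι] (A : Matrix ι ι ℍ[ℝ]) : ℕ :=
  sInf {k : ℕ | 0 < k ∧ rk (A ^ (k + 1)) = rk (A ^ k)}

end Rank

/-! ### Auxiliary facts: existence and uniqueness of the generalized inverses -/

section Aux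

theorem exists_pow_eq {B : Type*} [Ring B] [Algebra ℝ B] [FiniteDimensional ℝ B] (h : B) :
    ∃ (k : ℕ) (q : Polynomial ℝ), h ^ k = h ^ (k + 1) * Polynomial.aeval h q := by
  have hint : IsIntegral ℝ h := Algebra.IsIntegral.isIntegral h
  have hp : minpoly ℝ h ≠ 0 := minpoly.ne_zero hint
  obtain ⟨g, hg, hdvd⟩ := Polynomial.exists_eq_pow_rootMultiplicity_mul_and_not_dvd
    (minpoly ℝ h) hp 0
  set k := (minpoly ℝ h).rootMultiplicity 0
  simp only [map_zero, sub_zero] at hg hdvd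
  have hc : g.coeff 0 ≠ 0 := fun h0 => hdvd (Polynomial.X_dvd_iff.mpr h0)
  have h0 : h ^ k * Polynomial.aeval h g = 0 := by
    have := minpoly.aeval ℝ h
    rw [hg] at this
    simpa using this
  refine ⟨k, -(Polynomial.C (g.coeff 0)⁻¹ * g.divX), ?_⟩
  have hsplit := Polynomial.X_mul_divX_add g
  have h1 : Polynomial.aeval h g = h * Polynomial.aeval h g.divX
      + algebraMap ℝ B (g.coeff 0) := by
    conv_lhs => rw [← hsplit, map_add, map_mul, Polynomial.aeval_X, Polynomial.aeval_C]
  rw [h1, mul_add, add_eq_zero_iff_neg_eq] at h0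
  have h2 : h ^ k = (g.coeff 0)⁻¹ • (h ^ k * algebraMap ℝ B (g.coeff 0)) := by
    rw [← Algebra.commutes, ← Algebra.smul_def, smul_smul, inv_mul_cancel₀ hc, one_smul]
  rw [h2, ← h0, map_neg, map_mul, Polynomial.aeval_C, ← Algebra.smul_def, mul_neg,
    mul_smul_comm, smul_neg, pow_succ, mul_assoc]

theorem commute_aeval {B : Type*} [Ring B] [Algebra ℝ B] (h : B) (q : Polynomial ℝ) :
    Commute h (Polynomial.aeval h q) := by
  have := congrArg (Polynomial.aeval h) (mul_comm Polynomial.X q)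
  rwa [map_mul, map_mul, Polynomial.aeval_X] at this

theorem eq_zero_of_conjTranspose_mul_self {ι κ : Type*} [Fintype ι]
    (B : Matrix ι κ ℍ[ℝ]) (h : Bᴴ * B = 0) : B = 0 := by
  ext1 i j
  have hj : (Bᴴ * B) j j = 0 := by rw [h]; rfl
  rw [Matrix.mul_apply] at hj
  have hj' : algebraMap ℝ ℍ[ℝ] (∑ i, Quaternion.normSq (B i j)) = 0 := by
    rw [← hj, map_sum]
    refine Finset.sum_congr rfl fun i _ => ?_
    rw [Matrix.conjTranspose_apply, Quaternion.star_mul_self]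
    rfl
  have hj'' : ∑ i, Quaternion.normSq (B i j) = 0 :=
    (algebraMap ℝ ℍ[ℝ]).injective (hj'.trans (map_zero _).symm)
  rw [Finset.sum_eq_zero_iff_of_nonneg (fun _ _ => Quaternion.normSq_nonneg)] at hj''
  exact Quaternion.normSq_eq_zero.mp (hj'' i (Finset.mem_univ i))

theorem mul_eq_zero_of_conjTranspose_mul {ι κ μ : Type*} [Fintype ι] [Fintype κ]
    (A : Matrix ι κ ℍ[ℝ]) (Z : Matrix κ μ ℍ[ℝ]) (h : Aᴴ * A * Z = 0) : A * Z = 0 := by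
  apply eq_zero_of_conjTranspose_mul_self
  rw [Matrix.conjTranspose_mul, Matrix.mul_assoc, ← Matrix.mul_assoc Aᴴ, h, Matrix.mul_zero]

theorem conjTranspose_aeval {κ : Type*} [Fintype κ] [DecidableEq κ]
    (H : Matrix κ κ ℍ[ℝ]) (hH : Hᴴ = H) (q : Polynomial ℝ) :
    (Polynomial.aeval H q)ᴴ = Polynomial.aeval H q := by
  induction q using Polynomial.induction_on' with
  | add p q hp hq => rw [map_add, Matrix.conjTranspose_add, hp, hq]
  | monomial n a =>
    rw [Polynomial.aeval_monomial, ← Algebra.smul_def]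
    ext1 i j
    rw [Matrix.conjTranspose_apply, Matrix.smul_apply, Matrix.smul_apply, Quaternion.star_smul,
      ← Matrix.conjTranspose_apply, Matrix.conjTranspose_pow, hH]

theorem mem_rowSpace_iff {ι κ : Type*} [Fintype ι] (A : Matrix ι κ ℍ[ℝ]) (v : κ → ℍ[ℝ]) :
    v ∈ Submodule.span ℍ[ℝ] (Set.range A.row) ↔ ∃ c : ι → ℍ[ℝ], Matrix.vecMul c A = v := by
  rw [Submodule.mem_span_range_iff_exists_fun]
  refine exists_congr fun c => ?_
  have : ∑ i, c i • A.row i = Matrix.vecMul c A := by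
    ext1 j
    simp [Matrix.vecMul, dotProduct, Finset.sum_apply]
  rw [this]

theorem rowSpace_mul_le {ι κ μ : Type*} [Fintype ι] [Fintype κ]
    (Y : Matrix ι κ ℍ[ℝ]) (C : Matrix κ μ ℍ[ℝ]) :
    Submodule.span ℍ[ℝ] (Set.range (Y * C).row) ≤ Submodule.span ℍ[ℝ] (Set.range C.row) := by
  rw [Submodule.span_le]
  rintro _ ⟨i, rfl⟩
  exact (mem_rowSpace_iff C _).mpr ⟨Y i, by ext1 j; simp [Matrix.vecMul, Matrix.mul_apply, dotProduct]⟩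

theorem exists_mul_of_rk_eq {ι κ μ : Type*} [Fintype ι] [Fintype κ] [Fintype μ]
    (Y : Matrix ι κ ℍ[ℝ]) (C : Matrix κ μ ℍ[ℝ]) (h : rk (Y * C) = rk C) :
    ∃ T : Matrix κ ι ℍ[ℝ], C = T * (Y * C) := by
  have heq := Submodule.eq_of_le_of_finrank_eq (rowSpace_mul_le Y C) h
  have : ∀ i : κ, ∃ c : ι → ℍ[ℝ], Matrix.vecMul c (Y * C) = C i := fun i => by
    rw [← mem_rowSpace_iff, heq]
    exact Submodule.subset_span ⟨i, rfl⟩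
  choose T hT using this
  refine ⟨Matrix.of T, ?_⟩
  ext1 i j
  rw [← hT i]
  rfl

theorem pow_eq_pow_add {B : Type*} [Monoid B] {v q : B} {k : ℕ}
    (h : v ^ k = v ^ (k + 1) * q) (i : ℕ) : v ^ k = v ^ (k + i) * q ^ i := by
  induction i with
  | zero => simp
  | succ i ih =>
    calc v ^ k = v ^ i * v ^ k * q ^ i := by rw [← pow_add, add_comm i k]; exact ih
      _ = v ^ i * (v ^ (k + 1) * q) * q ^ i := by rw [← h]
      _ = v ^ (k + (i + 1)) * q ^ (i + 1) := by
        rw [pow_succ' q, ← mul_assoc, ← mul_assoc, ← pow_add]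
        congr 3
        omega

variable {κ : Type*} [Fintype κ] [DecidableEq κ]

theorem ind_spec (V : Matrix κ κ ℍ[ℝ]) : rk (V ^ (ind V + 1)) = rk (V ^ ind V) := by
  have hne : {k : ℕ | 0 < k ∧ rk (V ^ (k + 1)) = rk (V ^ k)}.Nonempty := by
    obtain ⟨k, q, hq⟩ := exists_pow_eq V
    refine ⟨k + 1, Nat.succ_pos _, ?_⟩
    have hc : Commute (Polynomial.aeval V q) V := (commute_aeval V q).symm
    unfold rk
    apply congrArg (fun S : Submodule ℍ[ℝ] (κ → ℍ[ℝ]) => Module.finrank ℍ[ℝ] S)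
    apply le_antisymm
    · rw [pow_succ' V (k + 1)]
      exact rowSpace_mul_le _ _
    · have : V ^ (k + 1) = Polynomial.aeval V q * V ^ (k + 1 + 1) := by
        rw [(hc.pow_right _).eq, pow_succ' V (k + 1), mul_assoc, ← hq, ← pow_succ']
      conv_lhs => rw [this]
      exact rowSpace_mul_le _ _
  exact (Nat.sInf_mem hne).2

theorem exists_drazin (V : Matrix κ κ ℍ[ℝ]) :
    ∃ D : Matrix κ κ ℍ[ℝ], V ^ (ind V + 1) * D = V ^ ind V ∧ D * V * D = D ∧ V * D = D * V := by
  set k := ind V with hk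
  obtain ⟨T, hT⟩ := exists_mul_of_rk_eq V (V ^ k) (by rw [← pow_succ']; exact ind_spec V)
  rw [← pow_succ'] at hT
  obtain ⟨j, p, hp⟩ := exists_pow_eq V
  set q := Polynomial.aeval V p
  have hc : Commute V q := commute_aeval V p
  have hT' : ∀ i, V ^ k = T ^ i * V ^ (k + i) := by
    intro i
    induction i with
    | zero => simp
    | succ i ih =>
      calc V ^ k = T ^ i * V ^ (k + i) := ih
        _ = T ^ i * (V ^ k * V ^ i) := by rw [pow_add]
        _ = T ^ i * (T * V ^ (k + 1) * V ^ i) := by rw [← hT]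
        _ = T ^ (i + 1) * V ^ (k + (i + 1)) := by
          rw [mul_assoc T, ← pow_add, pow_succ T, mul_assoc, add_right_comm, add_assoc]
  have hq : V ^ k = V ^ (k + 1) * q := by
    have h1 : V ^ (k + j) = V ^ (k + j) * V * q := by
      rw [← pow_succ, pow_add V k j, hp, ← mul_assoc, ← pow_add]
      rfl
    calc V ^ k = T ^ j * (V ^ (k + j) * V * q) := by rw [← h1]; exact hT' j
      _ = V ^ (k + 1) * q := by rw [← mul_assoc, ← mul_assoc, ← hT' j, ← pow_succ]
  have hpow := pow_eq_pow_add hq (k + 1)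
  refine ⟨V ^ k * q ^ (k + 1), ?_, ?_, ?_⟩
  · rw [← mul_assoc, ← pow_add, hpow]
    congr 2
    omega
  · have hcq : Commute (q ^ (k + 1)) (V * V ^ k) :=
      ((hc.pow_right (k + 1)).symm).mul_right ((hc.pow_pow k (k + 1)).symm)
    calc V ^ k * q ^ (k + 1) * V * (V ^ k * q ^ (k + 1))
        = V ^ k * (q ^ (k + 1) * (V * V ^ k)) * q ^ (k + 1) := by simp only [mul_assoc]
      _ = V ^ (k + (k + 1)) * q ^ (k + 1) * q ^ (k + 1) := by
        rw [hcq.eq, ← pow_succ', ← mul_assoc, ← pow_add]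
      _ = V ^ k * q ^ (k + 1) := by rw [← hpow]
  · exact ((Commute.refl V).pow_right k).mul_right (hc.pow_right (k + 1))

end Aux

/-! ### Moore–Penrose, weighted Drazin and weighted CMP inverses -/

section GenInverses

/-- `X` satisfies the four Penrose equations for `A`. -/
def IsMoorePenrose {ι κ : Type*} [Fintype ι] [Fintype κ]
    (A : Matrix ι κ ℍ[ℝ]) (X : Matrix κ ι ℍ[ℝ]) : Prop :=
  A * X * A = A ∧ X * A * X = X ∧ (A * X)ᴴ = A * X ∧ (X * A)ᴴ = X * A

theorem existsUnique_moorePenrose {ι κ : Type*} [Fintype ι] [Fintype κ] [DecidableEq κ]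
    (A : Matrix ι κ ℍ[ℝ]) : ∃! X : Matrix κ ι ℍ[ℝ], IsMoorePenrose A X := by
  obtain ⟨k, q, hq⟩ := exists_pow_eq (Aᴴ * A)
  set H := Aᴴ * A with hHdef
  have hH : Hᴴ = H := by simp [hHdef, Matrix.conjTranspose_mul]
  set s := Polynomial.aeval H q
  have hs : sᴴ = s := conjTranspose_aeval H hH q
  have hc : Commute H s := commute_aeval H q
  have hcancel : ∀ (i : ℕ) (Y : Matrix κ κ ℍ[ℝ]), H ^ i * Y = 0 → H * Y = 0 := by
    intro i
    induction i with
    | zero => intro Y h; rw [pow_zero, one_mul] at h; rw [h, mul_zero]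
    | succ i ih =>
      intro Y h
      rw [pow_succ, mul_assoc] at h
      have h2 := ih _ h
      apply mul_eq_zero_of_conjTranspose_mul
      rw [hH, mul_assoc]
      exact h2
  have h1 : H * (1 - H * s) = 0 := by
    apply hcancel k
    rw [mul_sub, mul_one, ← mul_assoc, ← pow_succ, ← hq, sub_self]
  have h2 : A * (1 - H * s) = 0 := mul_eq_zero_of_conjTranspose_mul _ _ h1
  have h3 : A * (H * s) = A := by
    rw [Matrix.mul_sub, Matrix.mul_one, sub_eq_zero] at h2
    exact h2.symm
  have h4 : s * H * Aᴴ = Aᴴ := by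
    have := congrArg Matrix.conjTranspose h3
    rwa [Matrix.conjTranspose_mul, Matrix.conjTranspose_mul, hs, hH] at this
  have hsA : s * Aᴴ * A = H * s := by rw [Matrix.mul_assoc, ← hHdef, hc.eq]
  have hmp : IsMoorePenrose A (s * Aᴴ) := by
    refine ⟨?_, ?_, ?_, ?_⟩
    · rw [Matrix.mul_assoc, hsA, h3]
    · rw [hsA, ← Matrix.mul_assoc, hc.eq, mul_assoc, hc.eq, Matrix.mul_assoc, h4]
    · rw [Matrix.conjTranspose_mul, Matrix.conjTranspose_mul, hs,
        Matrix.conjTranspose_conjTranspose, Matrix.mul_assoc]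
    · rw [hsA, Matrix.conjTranspose_mul, hs, hH, hc.eq]
  refine ⟨s * Aᴴ, hmp, fun Y hY => ?_⟩
  have huniq : ∀ X Y : Matrix κ ι ℍ[ℝ], IsMoorePenrose A X → IsMoorePenrose A Y → X = Y := by
    rintro X Y ⟨x1, x2, x3, x4⟩ ⟨y1, y2, y3, y4⟩
    have e1 : A * X = A * Y := by
      calc A * X = (A * X)ᴴ := x3.symm
        _ = (A * Y * (A * X))ᴴ := by rw [← Matrix.mul_assoc, y1]
        _ = A * X * (A * Y) := by rw [Matrix.conjTranspose_mul, x3, y3]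
        _ = A * Y := by rw [← Matrix.mul_assoc, x1]
    have e2 : X * A = Y * A := by
      calc X * A = (X * A)ᴴ := x4.symm
        _ = (X * A * (Y * A))ᴴ := by
          rw [Matrix.mul_assoc X A, ← Matrix.mul_assoc A, y1]
        _ = Y * A * (X * A) := by rw [Matrix.conjTranspose_mul, x4, y4]
        _ = Y * A := by rw [Matrix.mul_assoc, ← Matrix.mul_assoc A, x1]
    calc X = X * A * X := x2.symm
      _ = Y * A * X := by rw [e2]
      _ = Y * A * Y := by rw [Matrix.mul_assoc, e1, ← Matrix.mul_assoc]
      _ = Y := y2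
  exact huniq Y _ hY hmp

/-- The Moore–Penrose inverse `A†`: the unique solution of the Penrose equations. -/
noncomputable def mpInv {ι κ : Type*} [Fintype ι] [Fintype κ] [DecidableEq κ]
    (A : Matrix ι κ ℍ[ℝ]) : Matrix κ ι ℍ[ℝ] :=
  (existsUnique_moorePenrose A).choose

/-- `X` satisfies the defining equations of the `W`-weighted Drazin inverse of `A`,
where `k = Ind (A W)`. -/
def IsWDrazin {ι κ : Type*} [Fintype ι] [Fintype κ] [DecidableEq ι]
    (A : Matrix ι κ ℍ[ℝ]) (W : Matrix κ ι ℍ[ℝ]) (X : Matrix ι κ ℍ[ℝ]) : Prop :=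
  (A * W) ^ (ind (A * W) + 1) * X * W = (A * W) ^ ind (A * W) ∧
    X * W * A * W * X = X ∧ A * W * X = X * W * A

theorem existsUnique_wDrazin {ι κ : Type*} [Fintype ι] [Fintype κ] [DecidableEq ι]
    (A : Matrix ι κ ℍ[ℝ]) (W : Matrix κ ι ℍ[ℝ]) :
    ∃! X : Matrix ι κ ℍ[ℝ], IsWDrazin A W X := by
  obtain ⟨D, d1, d2, d3⟩ := exists_drazin (A * W)
  set V := A * W with hV
  set k := ind V
  have hW : D * D * A * W = D := by
    rw [Matrix.mul_assoc, ← hV, mul_assoc, ← d3, ← mul_assoc, d2]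
  have hL : V * (D * D * A) = D * A := by
    rw [← Matrix.mul_assoc, ← mul_assoc, d3, d2]
  refine ⟨D * D * A, ⟨?_, ?_, ?_⟩, ?_⟩
  · rw [← hV, Matrix.mul_assoc, hW, d1]
  · rw [hW, Matrix.mul_assoc D A W, ← hV, Matrix.mul_assoc, hL, ← Matrix.mul_assoc]
  · rw [← hV, hL, hW]
  · rintro X ⟨x1, x2, x3⟩
    rw [← hV] at x1 x3
    have z1 : V ^ (k + 1) * (X * W) = V ^ k := by rw [← Matrix.mul_assoc]; exact x1
    have z3 : V * (X * W) = X * W * V := by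
      rw [← Matrix.mul_assoc, x3, Matrix.mul_assoc (X * W) A W]
    have z2 : X * W * V * (X * W) = X * W := by
      rw [hV, ← Matrix.mul_assoc, ← Matrix.mul_assoc, x2]
    set Z := X * W with hZ
    have key : ∀ P Q : Matrix ι ι ℍ[ℝ], V ^ (k + 1) * P = V ^ k → P * V * P = P → V * P = P * V →
        V ^ (k + 1) * Q = V ^ k → Q * V * Q = Q → V * Q = Q * V → P = P * V * Q := by
      intro P Q p1 p2 p3 q1 q2 q3
      have hp : ∀ i, P = P ^ (i + 1) * V ^ i := by
        intro i
        induction i with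
        | zero => simp
        | succ i ih =>
          have hc : Commute V P := p3
          calc P = P * V * P := p2.symm
            _ = P * V * (P ^ (i + 1) * V ^ i) := by rw [← ih]
            _ = P * (V * P ^ (i + 1)) * V ^ i := by simp only [mul_assoc]
            _ = P * (P ^ (i + 1) * V) * V ^ i := by rw [(hc.pow_right (i + 1)).eq]
            _ = P ^ (i + 1 + 1) * V ^ (i + 1) := by
              rw [pow_succ' P (i + 1), pow_succ' V i]
              simp only [mul_assoc]
      calc P = P ^ (k + 1) * V ^ k := hp k
        _ = P ^ (k + 1) * (V ^ (k + 1) * Q) := by rw [q1]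
        _ = P ^ (k + 1) * V ^ k * V * Q := by rw [pow_succ V]; simp only [mul_assoc]
        _ = P * V * Q := by rw [← hp k]
    have a1 := key Z D z1 z2 z3 d1 d2 d3
    have a2 := key D Z d1 d2 d3 z1 z2 z3
    have hc1 : Commute V Z := z3
    have hc2 : Commute V D := d3
    have hZD : Z = D := by
      have kw : ∀ P Q : Matrix ι ι ℍ[ℝ], V ^ (k + 1) * P = V ^ k → P * V * P = P →
          V * P = P * V → V ^ (k + 1) * Q = V ^ k → Q * V * Q = Q → V * Q = Q * V →
          P = Q * V * P := by
        intro P Q p1 p2 p3 q1 q2 q3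
        have hp : ∀ i, P = V ^ i * P ^ (i + 1) := by
          intro i
          induction i with
          | zero => simp
          | succ i ih =>
            have hc : Commute V P := p3
            calc P = P * V * P := p2.symm
              _ = V * P * P := by rw [p3]
              _ = V * (V ^ i * P ^ (i + 1)) * P := by rw [← ih]
              _ = V ^ (i + 1) * P ^ (i + 1 + 1) := by
                rw [pow_succ' V i, pow_succ P (i + 1)]
                simp only [mul_assoc]
        have hq : Q * V ^ (k + 1) = V ^ k := by
          have hc : Commute V Q := q3
          rw [← (hc.pow_left (k + 1)).eq, q1]
        calc P = V ^ k * P ^ (k + 1) := hp k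
          _ = Q * V ^ (k + 1) * P ^ (k + 1) := by rw [hq]
          _ = Q * V * (V ^ k * P ^ (k + 1)) := by rw [pow_succ' V]; simp only [mul_assoc]
          _ = Q * V * P := by rw [← hp k]
      exact (kw Z D z1 z2 z3 d1 d2 d3).trans a2.symm
    calc X = Z * A * W * X := x2.symm
      _ = Z * (V * X) := by rw [hV]; simp only [Matrix.mul_assoc]
      _ = D * D * A := by rw [x3, hZD]; simp only [Matrix.mul_assoc]

/-- The `W`-weighted Drazin inverse `A^{d,W}`: the unique solution of its defining equations. -/
noncomputable def wDrazin {ι κ : Type*} [Fintype ι] [Fintype κ] [DecidableEq ι]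
    (A : Matrix ι κ ℍ[ℝ]) (W : Matrix κ ι ℍ[ℝ]) : Matrix ι κ ℍ[ℝ] :=
  (existsUnique_wDrazin A W).choose

/-- The weighted CMP inverse `A^{c,†,W} = A† A W A^{d,W} W A A†`. -/
noncomputable def wCMP {ι κ : Type*} [Fintype ι] [Fintype κ] [DecidableEq ι] [DecidableEq κ]
    (A : Matrix ι κ ℍ[ℝ]) (W : Matrix κ ι ℍ[ℝ]) : Matrix κ ι ℍ[ℝ] :=
  mpInv A * A * W * wDrazin A W * W * A * mpInv A

end GenInverses

/-! ### Row and column determinants -/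

section Determinants

variable {ι : Type*} [Fintype ι] [LinearOrder ι]

/-- The product of entries along the cycle of `σ` through `s`, read off starting from `s`:
`a_{s, σ s} a_{σ s, σ² s} ⋯ a_{σˡ s, s}`, where `l + 1` is the length of the cycle. -/
noncomputable def cycleProd (A : Matrix ι ι ℍ[ℝ]) (σ : Equiv.Perm ι) (s : ι) : ℍ[ℝ] :=
  ((List.range (Function.minimalPeriod σ s)).map
    fun t => A ((σ ^ t) s) ((σ ^ (t + 1)) s)).prod

open scoped Classical in
/-- The least elements of the cycles of `σ` (fixed points included) that do not contain `i`,
in increasing order. -/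
noncomputable def leaders (σ : Equiv.Perm ι) (i : ι) : List ι :=
  (Finset.univ.filter fun s => ¬ σ.SameCycle i s ∧ ∀ t, σ.SameCycle s t → s ≤ t).sort (· ≤ ·)

/-- The `i`-th row determinant. Each permutation is written as a product of disjoint cycles: the
first cycle from the left starts with `i`, every other one starts with its least element, and
these least elements increase from left to right. The sign is `(-1) ^ (n - r)`, where `r` is the
number of cycles. -/
noncomputable def rdet (i : ι) (A : Matrix ι ι ℍ[ℝ]) : ℍ[ℝ] :=
  ∑ σ : Equiv.Perm ι, (-1 : ℍ[ℝ]) ^ (Fintype.card ι - ((leaders σ i).length + 1)) *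
    (cycleProd A σ i * ((leaders σ i).map (cycleProd A σ)).prod)

/-- The `j`-th column determinant. Here the cycles are ordered from right to left: the first cycle
from the right is the one of `j`, every other one is closed at its least element, and these least
elements increase from right to left. -/
noncomputable def cdet (j : ι) (A : Matrix ι ι ℍ[ℝ]) : ℍ[ℝ] :=
  ∑ τ : Equiv.Perm ι, (-1 : ℍ[ℝ]) ^ (Fintype.card ι - ((leaders τ j).length + 1)) *
    (((leaders τ j).reverse.map (cycleProd A τ)).prod * cycleProd A τ j)

open scoped Classical in
/-- The determinant of a Hermitian matrix, expanded along its first row (for Hermitian matrices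
all row and column determinants agree). The determinant of the empty matrix is `1`. -/
noncomputable def hdet (A : Matrix ι ι ℍ[ℝ]) : ℍ[ℝ] :=
  if h : (Finset.univ : Finset ι).Nonempty then rdet (Finset.univ.min' h) A else 1

/-- The principal submatrix with rows and columns indexed by `α`. -/
def principal (B : Matrix ι ι ℍ[ℝ]) (α : Finset ι) : Matrix α α ℍ[ℝ] :=
  B.submatrix (fun x => (x : ι)) (fun x => (x : ι))

/-- `∑_{α ∈ I_r{j}} rdet_j ((B_{j.}(b))_α^α)`: the sum over the `r`-element index sets `α`
containing `j`, where the `j`-th row of `B` is replaced with `b`. -/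
noncomputable def rdetSum (r : ℕ) (B : Matrix ι ι ℍ[ℝ]) (j : ι) (b : ι → ℍ[ℝ]) : ℍ[ℝ] :=
  ∑ α : {α : Finset ι // α.card = r ∧ j ∈ α},
    rdet (⟨j, α.2.2⟩ : α.1) (principal (B.updateRow j b) α.1)

/-- `∑_{β ∈ J_r{i}} cdet_i ((B_{.i}(c))_β^β)`: the sum over the `r`-element index sets `β`
containing `i`, where the `i`-th column of `B` is replaced with `c`. -/
noncomputable def cdetSum (r : ℕ) (B : Matrix ι ι ℍ[ℝ]) (i : ι) (c : ι → ℍ[ℝ]) : ℍ[ℝ] :=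
  ∑ β : {β : Finset ι // β.card = r ∧ i ∈ β},
    cdet (⟨i, β.2.2⟩ : β.1) (principal (B.updateCol i c) β.1)

/-- `∑_α |B|_α^α`: the sum of the principal minors of order `r` of a Hermitian matrix `B`. -/
noncomputable def minorSum (r : ℕ) (B : Matrix ι ι ℍ[ℝ]) : ℍ[ℝ] :=
  ∑ α : {α : Finset ι // α.card = r}, hdet (principal B α.1)

end Determinants

end QuatMat

open QuatMat

set_option linter.unusedSectionVars false

namespace QuatMat

open Equiv Equiv.Perm

/-! ### Row and column determinants on principal index sets, and their expansion along a row. -/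

section PermDeterminants

variable {ι : Type*} [Fintype ι] [LinearOrder ι]

/-! Both formulas come from two facts: a sum of row (column) determinants is multiplication by a
Moore–Penrose inverse up to a real factor, and the weighted CMP inverse is a product of
Moore–Penrose inverses and powers.

For Hermitian `B`, expanding a row determinant along its replaced row (`rdetIn_updateRow`) defines
cofactors. Strong induction on the index set (`isAdjugateOn_of_hermitian`) shows that the principal
minors are real and independent of the row, and that the cofactors form a Hermitian adjugate.
Summing over all sets of a given size gives the recursion `rdetSum_succ_add` of Faddeev–LeVerrier
type. Hence the map sending `b` to `rdetSum q B · b` is right multiplication by a real polynomial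
`adjCoef B q` in `B`, and the real trace of `B * adjCoef B q` is `q` times the sum of minors.

Let `s` be the largest order with nonzero sum of minors `d`. The recursion stops there, so `d⁻¹ •
(adjCoef B s * B)` is the orthogonal projection onto the range of `B`. Its real trace is `s`, so for
the Gram matrices of `A` this order is `rk A` (`isTopOrder_gram`). Moreover `Aᴴ * adjCoef (A * Aᴴ)
s` equals `d` times the Moore–Penrose inverse of `A`, which yields `of_rdetSum_row` and, by
conjugate transposition, `of_cdetSum_col`.

With `P` the Moore–Penrose inverse of `U ^ (2 * k + 1)`, the Drazin inverse of `U` is `U ^ k * P * U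
^ k` (`IsDrazin.eq_mpInv`), and the weighted Drazin inverse is `A` times its square. Each nested
determinantal sum of the theorem contributes one factor `P` or one Moore–Penrose inverse of `A`,
together with a sum of minors. The product is the weighted CMP inverse, scaled by the denominator;
the sums of minors of `A * Aᴴ` and `Aᴴ * A` agree, which gives the square. Part (ii) is the mirror
image. -/

theorem sameCycle_iff_exists_nat {κ : Type*} [Finite κ] {σ : Perm κ} {s t : κ} :
    σ.SameCycle s t ↔ ∃ n : ℕ, (σ ^ n) s = t :=
  ⟨fun h => h.exists_nat_pow_eq, fun ⟨n, hn⟩ => ⟨n, by simpa using hn⟩⟩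

open scoped Classical in
/-- The least elements of the cycles of `σ` inside `α` that do not contain `j`, in increasing
order. -/
noncomputable def leadersIn (α : Finset ι) (σ : Perm ι) (j : ι) : List ι :=
  (α.filter fun s => ¬ σ.SameCycle j s ∧ ∀ t, σ.SameCycle s t → s ≤ t).sort (· ≤ ·)

open scoped Classical in
/-- The permutations that fix every element outside `α`. -/
noncomputable def permsIn (α : Finset ι) : Finset (Perm ι) :=
  Finset.univ.filter fun σ => ∀ x ∉ α, σ x = x

theorem mem_permsIn {α : Finset ι} {σ : Perm ι} : σ ∈ permsIn α ↔ ∀ x ∉ α, σ x = x := by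
  simp [permsIn]

/-- The signed product of the cycles of `σ` which contributes to the row determinant. -/
noncomputable def rdetTerm (α : Finset ι) (j : ι) (M : Matrix ι ι ℍ[ℝ]) (σ : Perm ι) : ℍ[ℝ] :=
  (-1 : ℍ[ℝ]) ^ (α.card - ((leadersIn α σ j).length + 1)) *
    (cycleProd M σ j * ((leadersIn α σ j).map (cycleProd M σ)).prod)

/-- The row determinant of a principal submatrix, as a sum over permutations of the ambient
index type. -/
noncomputable def rdetIn (α : Finset ι) (j : ι) (M : Matrix ι ι ℍ[ℝ]) : ℍ[ℝ] :=
  ∑ σ ∈ permsIn α, rdetTerm α j M σ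

theorem minimalPeriod_congr_pow {κ μ : Type*} {σ : Perm κ} {τ : Perm μ} {s : κ} {t : μ}
    (h : ∀ n : ℕ, (σ ^ n) s = s ↔ (τ ^ n) t = t) :
    Function.minimalPeriod σ s = Function.minimalPeriod τ t := by
  rw [Function.minimalPeriod_eq_minimalPeriod_iff]
  intro n
  have := h n
  rw [← Perm.iterate_eq_pow, ← Perm.iterate_eq_pow] at this
  exact this

theorem minimalPeriod_pos (σ : Perm ι) (s : ι) : 0 < Function.minimalPeriod σ s := by
  apply Function.minimalPeriod_pos_of_mem_periodicPts
  refine ⟨orderOf σ, orderOf_pos σ, ?_⟩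
  change (σ^[orderOf σ]) s = s
  rw [Perm.iterate_eq_pow, pow_orderOf_eq_one, Perm.one_apply]

theorem pow_minimalPeriod_apply (σ : Perm ι) (s : ι) :
    (σ ^ Function.minimalPeriod σ s) s = s := by
  rw [← Perm.iterate_eq_pow]
  exact Function.isPeriodicPt_minimalPeriod σ s

theorem pow_apply_ne_of_lt {σ : Perm ι} {s : ι} {t : ℕ} (h0 : 0 < t)
    (h : t < Function.minimalPeriod σ s) : (σ ^ t) s ≠ s := by
  intro he
  rw [← Perm.iterate_eq_pow] at he
  exact absurd (Function.IsPeriodicPt.minimalPeriod_le h0 he) (by omega)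

theorem cycleProd_congr {M M' : Matrix ι ι ℍ[ℝ]} {σ τ : Perm ι} {s : ι}
    (h : ∀ n : ℕ, (σ ^ n) s = (τ ^ n) s) (hM : ∀ n : ℕ, M ((τ ^ n) s) = M' ((τ ^ n) s)) :
    cycleProd M σ s = cycleProd M' τ s := by
  unfold cycleProd
  rw [minimalPeriod_congr_pow (σ := σ) (τ := τ) (s := s) (t := s) (fun n => by rw [h n])]
  congr 1
  apply List.map_congr_left
  intro t _
  rw [h, h, hM]

theorem cycleProd_of_fixed {M : Matrix ι ι ℍ[ℝ]} {σ : Perm ι} {s : ι} (h : σ s = s) :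
    cycleProd M σ s = M s s := by
  have : Function.minimalPeriod σ s = 1 := by
    rw [Function.minimalPeriod_eq_one_iff_isFixedPt]; exact h
  simp [cycleProd, this, List.range_succ, h]

/-! #### Splicing an element into a cycle -/

section Splice

variable {τ : Perm ι} {i j : ι}

/-- If `τ` fixes `i`, then `τ * swap j i` sends `j` to `i` and `i` to `τ j`: it inserts `i` into the
cycle of `j`, right after `j`, and leaves the other cycles alone. Every permutation sending `j` to
`i ≠ j` arises once in this way, which drives the row expansion. -/
theorem splice_apply_of_ne {x : ι} (hxi : x ≠ i) (hxj : x ≠ j) :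
    (τ * swap j i) x = τ x := by
  rw [Perm.mul_apply, swap_apply_of_ne_of_ne hxj hxi]

theorem splice_pow_apply (hi : τ i = i) {s : ι} (hs : ¬ τ.SameCycle j s) (hsi : s ≠ i) (n : ℕ) :
    ((τ * swap j i) ^ n) s = (τ ^ n) s := by
  induction n with
  | zero => rfl
  | succ n ih =>
    rw [pow_succ', Perm.mul_apply, ih, splice_apply_of_ne, pow_succ', Perm.mul_apply]
    · intro h
      apply hsi
      have h2 : (τ ^ n) i = i := by
        rw [← Perm.iterate_eq_pow]; exact Function.iterate_fixed hi n
      exact (τ ^ n).injective (h.trans h2.symm)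
    · intro h
      exact hs (SameCycle.symm (sameCycle_iff_exists_nat.mpr ⟨n, h⟩))

theorem sameCycle_splice_self (hij : i ≠ j) (hi : τ i = i) {s : ι} :
    (τ * swap j i).SameCycle j s ↔ s = i ∨ τ.SameCycle j s := by
  have hji : (τ * swap j i) j = i := by simp [hi]
  constructor
  · intro h
    by_contra hcon
    push Not at hcon
    obtain ⟨n, hn⟩ := sameCycle_iff_exists_nat.mp h.symm
    rw [splice_pow_apply hi hcon.2 hcon.1] at hn
    exact hcon.2 (SameCycle.symm (sameCycle_iff_exists_nat.mpr ⟨n, hn⟩))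
  · rintro (rfl | h)
    · exact ⟨1, by simpa using hji⟩
    · by_contra hcon
      have hsj : ∀ n : ℕ, ((τ * swap j i) ^ n) s ≠ j := fun n hn =>
        hcon (SameCycle.symm (sameCycle_iff_exists_nat.mpr ⟨n, hn⟩))
      have hsi : ∀ n : ℕ, ((τ * swap j i) ^ n) s ≠ i := fun n hn => by
        apply hcon
        have h1 : (τ * swap j i).SameCycle s i := sameCycle_iff_exists_nat.mpr ⟨n, hn⟩
        have h2 : (τ * swap j i).SameCycle j i := ⟨1, by simpa using hji⟩
        exact h2.trans h1.symm
      have key : ∀ n : ℕ, ((τ * swap j i) ^ n) s = (τ ^ n) s := by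
        intro n
        induction n with
        | zero => rfl
        | succ n ih =>
          rw [pow_succ', Perm.mul_apply, splice_apply_of_ne (hsi n) (hsj n), ih, pow_succ',
            Perm.mul_apply]
      obtain ⟨n, hn⟩ := sameCycle_iff_exists_nat.mp h.symm
      exact hsj n ((key n).trans hn)

/-- The spliced cycle visits the points of the old one with a delay of one step. The case `t = 0` is
excluded because after one step the new cycle is at `i`, not at `j`. -/
theorem splice_pow_succ_apply_self (hij : i ≠ j) (hi : τ i = i) {t : ℕ} (h0 : 0 < t)
    (ht : t ≤ Function.minimalPeriod τ j) : ((τ * swap j i) ^ (t + 1)) j = (τ ^ t) j := by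
  induction t with
  | zero => omega
  | succ t ih =>
    rcases Nat.eq_zero_or_pos t with rfl | hpos
    · simp [pow_two, hi]
    · rw [pow_succ', Perm.mul_apply, ih hpos (by omega), splice_apply_of_ne, pow_succ' τ,
        Perm.mul_apply]
      · intro h
        have h2 : (τ ^ t) i = i := by
          rw [← Perm.iterate_eq_pow]; exact Function.iterate_fixed hi t
        exact hij ((τ ^ t).injective (h2.trans h.symm))
      · exact pow_apply_ne_of_lt hpos (by omega)

theorem minimalPeriod_splice (hij : i ≠ j) (hi : τ i = i) :
    Function.minimalPeriod (τ * swap j i) j = Function.minimalPeriod τ j + 1 := by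
  have hpos := minimalPeriod_pos τ j
  apply le_antisymm
  · apply Function.IsPeriodicPt.minimalPeriod_le (Nat.succ_pos _)
    change ((τ * swap j i)^[_]) j = j
    rw [Perm.iterate_eq_pow, splice_pow_succ_apply_self hij hi hpos le_rfl,
      pow_minimalPeriod_apply]
  · by_contra hlt
    push Not at hlt
    have hq := minimalPeriod_pos (τ * swap j i) j
    have hfix := pow_minimalPeriod_apply (τ * swap j i) j
    obtain ⟨q, hq'⟩ : ∃ q, Function.minimalPeriod (τ * swap j i) j = q + 1 :=
      ⟨_, (Nat.succ_pred_eq_of_pos hq).symm⟩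
    rw [hq'] at hfix hlt
    rcases Nat.eq_zero_or_pos q with rfl | hq0
    · simp [hi] at hfix
      exact hij hfix
    · rw [splice_pow_succ_apply_self hij hi hq0 (by omega)] at hfix
      exact pow_apply_ne_of_lt hq0 (by omega) hfix

/-- The step from `j` to `i` gives `b i`; the next factor lies in row `i` of `M`. Placing that row
in position `j` lets the rest of the product be read as a cycle of `τ` starting at `j`. -/
theorem cycleProd_splice (hij : i ≠ j) (hi : τ i = i) (M : Matrix ι ι ℍ[ℝ]) (b : ι → ℍ[ℝ]) :
    cycleProd (M.updateRow j b) (τ * swap j i) j =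
      b i * cycleProd (M.updateRow j (M i)) τ j := by
  unfold cycleProd
  rw [minimalPeriod_splice hij hi, List.range_succ_eq_map, List.map_cons, List.prod_cons,
    List.map_map]
  congr 1
  · simp [hi]
  · congr 1
    apply List.map_congr_left
    intro t ht
    rw [List.mem_range] at ht
    simp only [Function.comp, Nat.succ_eq_add_one]
    rw [splice_pow_succ_apply_self hij hi (Nat.succ_pos t) ht]
    rcases Nat.eq_zero_or_pos t with rfl | hpos
    · simp [hi, hij]
    · rw [splice_pow_succ_apply_self hij hi hpos ht.le, Matrix.updateRow_ne,
        Matrix.updateRow_ne] <;> exact pow_apply_ne_of_lt hpos ht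

theorem leadersIn_splice {α : Finset ι} (hij : i ≠ j) (hτ : τ ∈ permsIn (α.erase i)) :
    leadersIn α (τ * swap j i) j = leadersIn (α.erase i) τ j := by
  have hi : τ i = i := mem_permsIn.mp hτ i (by simp)
  unfold leadersIn
  congr 1
  ext s
  simp only [Finset.mem_filter, Finset.mem_erase, sameCycle_splice_self hij hi]
  have key : s ≠ i → ¬ τ.SameCycle j s → ∀ t, (τ * swap j i).SameCycle s t ↔ τ.SameCycle s t := by
    intro h1 h2 t
    simp only [sameCycle_iff_exists_nat, splice_pow_apply hi h2 h1]
  constructor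
  · rintro ⟨h1, h2, h3⟩
    push Not at h2
    exact ⟨⟨h2.1, h1⟩, h2.2, fun t ht => h3 t ((key h2.1 h2.2 t).mpr ht)⟩
  · rintro ⟨⟨h1, h2⟩, h3, h4⟩
    exact ⟨h2, by tauto, fun t ht => h4 t ((key h1 h3 t).mp ht)⟩

theorem leadersIn_length_lt {α : Finset ι} (σ : Perm ι) (hj : j ∈ α) :
    (leadersIn α σ j).length < α.card := by
  rw [leadersIn, Finset.length_sort]
  apply Finset.card_lt_card
  rw [Finset.filter_ssubset]
  exact ⟨j, hj, fun h => h.1 (SameCycle.refl σ j)⟩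

theorem mem_leadersIn {α : Finset ι} {σ : Perm ι} {s : ι} :
    s ∈ leadersIn α σ j ↔ s ∈ α ∧ ¬ σ.SameCycle j s ∧ ∀ t, σ.SameCycle s t → s ≤ t := by
  simp [leadersIn]

/-- Splicing adds one element but no cycle, so the sign flips. The factor `b i` stays leftmost
because the cycle through `j` is written first. -/
theorem rdetTerm_splice {α : Finset ι} (hj : j ∈ α) (hiα : i ∈ α) (hij : i ≠ j)
    (hτ : τ ∈ permsIn (α.erase i)) (M : Matrix ι ι ℍ[ℝ]) (b : ι → ℍ[ℝ]) :
    rdetTerm α j (M.updateRow j b) (τ * swap j i) =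
      -(b i * rdetTerm (α.erase i) j (M.updateRow j (M i)) τ) := by
  have hi : τ i = i := mem_permsIn.mp hτ i (by simp)
  unfold rdetTerm
  rw [leadersIn_splice hij hτ, cycleProd_splice hij hi]
  have hlen := leadersIn_length_lt (α := α.erase i) τ (Finset.mem_erase.mpr ⟨hij.symm, hj⟩)
  have hcard := Finset.card_erase_add_one hiα
  have hexp : α.card - ((leadersIn (α.erase i) τ j).length + 1) =
      (α.erase i).card - ((leadersIn (α.erase i) τ j).length + 1) + 1 := by omega
  rw [hexp, pow_succ]
  have hmap : (leadersIn (α.erase i) τ j).map (cycleProd (M.updateRow j b) (τ * swap j i)) =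
      (leadersIn (α.erase i) τ j).map (cycleProd (M.updateRow j (M i)) τ) := by
    apply List.map_congr_left
    intro s hs
    obtain ⟨h1, h2, -⟩ := mem_leadersIn.mp hs
    apply cycleProd_congr (splice_pow_apply hi h2 (Finset.mem_erase.mp h1).1)
    intro n
    have : (τ ^ n) s ≠ j := fun h =>
      h2 (SameCycle.symm (sameCycle_iff_exists_nat.mpr ⟨n, h⟩))
    rw [Matrix.updateRow_ne this, Matrix.updateRow_ne this]
  rw [hmap]
  have hc : ∀ (e : ℕ) (x y : ℍ[ℝ]), (-1 : ℍ[ℝ]) ^ e * -1 * (b i * x * y) =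
      -(b i * ((-1 : ℍ[ℝ]) ^ e * (x * y))) := by
    intro e x y
    rcases neg_one_pow_eq_or ℍ[ℝ] e with h | h <;> rw [h] <;> simp [mul_assoc]
  exact hc _ _ _

end Splice

/-- The minor on `α`, expanded along the row of its least element. -/
noncomputable def minorIn (α : Finset ι) (M : Matrix ι ι ℍ[ℝ]) : ℍ[ℝ] :=
  if h : α.Nonempty then rdetIn α (α.min' h) M else 1

theorem fixed_of_mem_permsIn_erase {α : Finset ι} {σ : Perm ι} {j : ι}
    (h : σ ∈ permsIn (α.erase j)) : σ j = j :=
  mem_permsIn.mp h j (by simp)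

theorem mem_of_sameCycle {α : Finset ι} {σ : Perm ι} (h : σ ∈ permsIn α) {s t : ι}
    (hst : σ.SameCycle s t) (hs : s ∈ α) : t ∈ α := by
  by_contra ht
  have h1 : σ t = t := mem_permsIn.mp h t ht
  obtain ⟨n, hn⟩ := sameCycle_iff_exists_nat.mp hst.symm
  rw [← Perm.iterate_eq_pow, Function.iterate_fixed h1] at hn
  exact ht (hn ▸ hs)

theorem sameCycle_of_fixed {σ : Perm ι} {j s : ι} (h : σ j = j) :
    σ.SameCycle j s ↔ s = j := by
  rw [sameCycle_iff_exists_nat]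
  constructor
  · rintro ⟨n, rfl⟩
    rw [← Perm.iterate_eq_pow, Function.iterate_fixed h]
  · rintro rfl
    exact ⟨0, rfl⟩

/-- The least element of what remains is the least element of its own cycle and precedes all other
leaders. Its cycle therefore comes next, as if the row determinant of the remaining set were started
there; this is why `minorIn` expands at the least element. -/
theorem leadersIn_of_fixed {α : Finset ι} {σ : Perm ι} {j : ι} (hσ : σ ∈ permsIn (α.erase j))
    (h : (α.erase j).Nonempty) : leadersIn α σ j =
      (α.erase j).min' h :: leadersIn (α.erase j) σ ((α.erase j).min' h) := by
  have hj := fixed_of_mem_permsIn_erase hσ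
  set m := (α.erase j).min' h with hm
  have hmem : m ∈ α.erase j := Finset.min'_mem _ _
  have hle : ∀ s ∈ α.erase j, m ≤ s := fun s hs => Finset.min'_le _ _ hs
  unfold leadersIn
  rw [← Finset.sort_insert (r := (· ≤ ·))]
  · congr 1
    ext s
    simp only [Finset.mem_filter, Finset.mem_insert, sameCycle_of_fixed hj]
    constructor
    · rintro ⟨h1, h2, h3⟩
      have hs : s ∈ α.erase j := Finset.mem_erase.mpr ⟨h2, h1⟩
      by_cases hsm : σ.SameCycle m s
      · left
        exact le_antisymm (h3 m hsm.symm) (hle s hs)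
      · exact Or.inr ⟨hs, hsm, h3⟩
    · rintro (rfl | ⟨h1, h2, h3⟩)
      · refine ⟨(Finset.mem_erase.mp hmem).2, (Finset.mem_erase.mp hmem).1, fun t ht => ?_⟩
        exact hle t (mem_of_sameCycle hσ ht hmem)
      · exact ⟨(Finset.mem_erase.mp h1).2, (Finset.mem_erase.mp h1).1, h3⟩
  · intro b hb
    exact hle b (Finset.mem_filter.mp hb).1
  · simp [SameCycle.refl]

theorem rdetTerm_of_fixed {α : Finset ι} {σ : Perm ι} {j : ι} (hj : j ∈ α)
    (hσ : σ ∈ permsIn (α.erase j)) (h : (α.erase j).Nonempty) (M : Matrix ι ι ℍ[ℝ])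
    (b : ι → ℍ[ℝ]) : rdetTerm α j (M.updateRow j b) σ =
      b j * rdetTerm (α.erase j) ((α.erase j).min' h) M σ := by
  have hjf := fixed_of_mem_permsIn_erase hσ
  have hmap : (leadersIn α σ j).map (cycleProd (M.updateRow j b) σ) =
      (leadersIn α σ j).map (cycleProd M σ) := by
    apply List.map_congr_left
    intro s hs
    obtain ⟨h1, h2, -⟩ := mem_leadersIn.mp hs
    refine cycleProd_congr (fun _ => rfl) fun n => ?_
    have : (σ ^ n) s ≠ j := fun h =>
      h2 (SameCycle.symm (sameCycle_iff_exists_nat.mpr ⟨n, h⟩))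
    rw [Matrix.updateRow_ne this]
  unfold rdetTerm
  rw [hmap, leadersIn_of_fixed hσ h, cycleProd_of_fixed hjf]
  have hcard := Finset.card_erase_add_one hj
  simp only [List.length_cons, List.map_cons, List.prod_cons, Matrix.updateRow_self]
  have hexp : ∀ l, α.card - (l + 1 + 1) = (α.erase j).card - (l + 1) := by intro l; omega
  rw [hexp]
  have hc : ∀ (e : ℕ) (x : ℍ[ℝ]), (-1 : ℍ[ℝ]) ^ e * (b j * x) = b j * ((-1 : ℍ[ℝ]) ^ e * x) := by
    intro e x
    rcases neg_one_pow_eq_or ℍ[ℝ] e with h | h <;> rw [h] <;> simp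
  exact hc _ _

/-- Expansion of the row determinant along the replaced row. -/
theorem rdetIn_updateRow {α : Finset ι} {j : ι} (hj : j ∈ α) (M : Matrix ι ι ℍ[ℝ])
    (b : ι → ℍ[ℝ]) : rdetIn α j (M.updateRow j b) = b j * minorIn (α.erase j) M +
      ∑ i ∈ α.erase j, -(b i * rdetIn (α.erase i) j (M.updateRow j (M i))) := by
  classical
  have hmaps : ∀ σ ∈ permsIn α, σ j ∈ α := by
    intro σ hσ
    exact mem_of_sameCycle hσ ⟨1, by simp⟩ hj
  unfold rdetIn
  -- Group the permutations by the image of `j`: the fibre over `j` gives the minor, each other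
  -- fibre a smaller row determinant.
  rw [← Finset.sum_fiberwise_of_maps_to hmaps, ← Finset.add_sum_erase α _ hj]
  congr 1
  · have hset : (permsIn α).filter (fun σ => σ j = j) = permsIn (α.erase j) := by
      ext σ
      simp only [Finset.mem_filter, mem_permsIn, Finset.mem_erase, not_and]
      constructor
      · rintro ⟨h1, h2⟩ x hx
        by_cases hxj : x = j
        · rw [hxj, h2]
        · exact h1 x (hx hxj)
      · intro h
        exact ⟨fun x hx => h x fun _ => hx, h j (by simp)⟩
    rw [hset]
    by_cases h : (α.erase j).Nonempty
    · rw [minorIn, dif_pos h, rdetIn, Finset.mul_sum]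
      exact Finset.sum_congr rfl fun σ hσ => rdetTerm_of_fixed hj hσ h M b
    · rw [minorIn, dif_neg h]
      -- Here `α = {j}`: only the identity contributes, and the empty minor has its default value
      -- `1`.
      rw [Finset.not_nonempty_iff_eq_empty] at h
      have h1 : permsIn (∅ : Finset ι) = {1} := by
        ext σ
        simp only [mem_permsIn, Finset.notMem_empty, not_false_eq_true, true_implies,
          Finset.mem_singleton]
        exact ⟨fun h => Perm.ext h, fun h => by simp [h]⟩
      have hα : α = {j} := by
        rw [← Finset.insert_erase hj, h]; rfl
      rw [h, h1, Finset.sum_singleton, rdetTerm, cycleProd_of_fixed (by simp)]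
      have : leadersIn α 1 j = [] := by
        rw [List.eq_nil_iff_forall_not_mem]
        intro s hs
        obtain ⟨h1, h2, -⟩ := mem_leadersIn.mp hs
        rw [hα, Finset.mem_singleton] at h1
        exact h2 (h1 ▸ SameCycle.refl _ _)
      rw [this]
      simp [hα]
  · refine Finset.sum_congr rfl fun i hi => ?_
    obtain ⟨hij, hiα⟩ := Finset.mem_erase.mp hi
    rw [Finset.mul_sum, ← Finset.sum_neg_distrib]
    symm
    -- Right multiplication by the transposition is its own inverse, so splicing is a bijection onto
    -- the fibre.
    refine Finset.sum_bij' (fun τ _ => τ * swap j i) (fun σ _ => σ * swap j i) ?_ ?_ ?_ ?_ ?_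
    · intro τ hτ
      have hτi := fixed_of_mem_permsIn_erase hτ
      simp only [Finset.mem_filter, mem_permsIn]
      refine ⟨fun x hx => ?_, by simp [hτi]⟩
      rw [splice_apply_of_ne (by rintro rfl; exact hx hiα) (by rintro rfl; exact hx hj)]
      exact mem_permsIn.mp hτ x (by simp [hx])
    · intro σ hσ
      obtain ⟨h1, h2⟩ := Finset.mem_filter.mp hσ
      rw [mem_permsIn] at h1 ⊢
      intro x hx
      by_cases hxi : x = i
      · simp [hxi, h2]
      · have hxα : x ∉ α := fun h => hx (Finset.mem_erase.mpr ⟨hxi, h⟩)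
        rw [Perm.mul_apply, swap_apply_of_ne_of_ne (by rintro rfl; exact hxα hj) hxi, h1 x hxα]
    · intro τ _
      simp [mul_assoc]
    · intro σ _
      simp [mul_assoc]
    · intro τ hτ
      exact (rdetTerm_splice hj hiα hij hτ M b).symm

/-! #### Transfer between a principal submatrix and the ambient matrix -/

theorem ofSubtype_pow_apply {α : Finset ι} (σ : Perm α) (n : ℕ) (s : α) :
    ((ofSubtype σ) ^ n) (s : ι) = ((σ ^ n) s : α) := by
  rw [← map_pow, ofSubtype_apply_coe]

theorem sameCycle_ofSubtype {α : Finset ι} (σ : Perm α) (s t : α) :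
    (ofSubtype σ).SameCycle (s : ι) t ↔ σ.SameCycle s t := by
  simp only [sameCycle_iff_exists_nat, ofSubtype_pow_apply, Subtype.ext_iff]

theorem cycleProd_principal {α : Finset ι} (M : Matrix ι ι ℍ[ℝ]) (σ : Perm α) (s : α) :
    cycleProd (principal M α) σ s = cycleProd M (ofSubtype σ) s := by
  unfold cycleProd
  rw [minimalPeriod_congr_pow (σ := σ) (τ := ofSubtype σ) (s := s) (t := s)
    (fun n => by rw [ofSubtype_pow_apply, Subtype.ext_iff])]
  congr 1
  apply List.map_congr_left
  intro t _
  rw [ofSubtype_pow_apply, ofSubtype_pow_apply]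
  rfl

theorem ofSubtype_mem_permsIn {α : Finset ι} (σ : Perm α) : ofSubtype σ ∈ permsIn α :=
  mem_permsIn.mpr fun _ hx => ofSubtype_apply_of_not_mem σ hx

theorem leaders_map_coe {α : Finset ι} (σ : Perm α) (j : α) :
    (leaders σ j).map (fun s : α => (s : ι)) = leadersIn α (ofSubtype σ) j := by
  unfold leaders leadersIn
  have hsort := Finset.map_sort (r := fun a b : α => a ≤ b) (r' := fun a b : ι => a ≤ b)
    (Function.Embedding.subtype (· ∈ α))
    (Finset.univ.filter fun s => ¬ σ.SameCycle j s ∧ ∀ t, σ.SameCycle s t → s ≤ t)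
    (fun a _ b _ => Iff.rfl)
  refine hsort.trans ?_
  congr 1
  ext s
  simp only [Finset.mem_map, Finset.mem_filter, Finset.mem_univ, true_and,
    Function.Embedding.subtype_apply]
  constructor
  · rintro ⟨a, ⟨h1, h2⟩, rfl⟩
    refine ⟨a.2, by rwa [sameCycle_ofSubtype], fun t ht => ?_⟩
    have htα := mem_of_sameCycle (ofSubtype_mem_permsIn σ) ht a.2
    exact h2 ⟨t, htα⟩ ((sameCycle_ofSubtype σ a ⟨t, htα⟩).mp ht)
  · rintro ⟨h1, h2, h3⟩
    refine ⟨⟨s, h1⟩, ⟨fun h => h2 ((sameCycle_ofSubtype σ j ⟨s, h1⟩).mpr h), fun t ht => ?_⟩, rfl⟩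
    exact h3 t ((sameCycle_ofSubtype σ ⟨s, h1⟩ t).mpr ht)

theorem rdet_principal {α : Finset ι} (j : α) (M : Matrix ι ι ℍ[ℝ]) :
    rdet j (principal M α) = rdetIn α j M := by
  unfold rdet rdetIn
  refine Finset.sum_bij (fun σ _ => ofSubtype σ) (fun σ _ => ofSubtype_mem_permsIn σ)
    (fun _ _ _ _ h => ofSubtype_injective h) ?_ ?_
  · intro τ hτ
    have hm := mem_permsIn.mp hτ
    have h1 : ∀ x, τ x ∈ α ↔ x ∈ α := fun x =>
      ⟨fun h => mem_of_sameCycle hτ (SameCycle.symm ⟨1, by simp⟩) h,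
        fun h => mem_of_sameCycle hτ ⟨1, by simp⟩ h⟩
    refine ⟨τ.subtypePerm h1, Finset.mem_univ _, ?_⟩
    exact ofSubtype_subtypePerm h1 fun x hx => by
      by_contra h
      exact hx (hm x h)
  · intro σ _
    have hfun : (leaders σ j).map (cycleProd (principal M α) σ) =
        (leadersIn α (ofSubtype σ) j).map (cycleProd M (ofSubtype σ)) := by
      rw [← leaders_map_coe, List.map_map]
      apply List.map_congr_left
      intro s _
      exact cycleProd_principal M σ s
    rw [rdetTerm, hfun, cycleProd_principal, Fintype.card_coe, ← leaders_map_coe, List.length_map]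

theorem hdet_principal (α : Finset ι) (M : Matrix ι ι ℍ[ℝ]) :
    hdet (principal M α) = minorIn α M := by
  unfold hdet minorIn
  by_cases h : α.Nonempty
  · have h' : (Finset.univ : Finset α).Nonempty := ⟨⟨_, h.choose_spec⟩, Finset.mem_univ _⟩
    rw [dif_pos h', dif_pos h, rdet_principal]
    congr 1
    apply le_antisymm
    · have hle := Finset.min'_le (Finset.univ : Finset α) ⟨α.min' h, Finset.min'_mem _ _⟩
        (Finset.mem_univ _)
      exact hle
    · exact Finset.min'_le _ _ (Subtype.coe_prop _)
  · have h' : ¬ (Finset.univ : Finset α).Nonempty := fun ⟨x, _⟩ => h ⟨x, x.2⟩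
    rw [dif_neg h', dif_neg h]

/-! #### Column determinants of conjugate transposes -/

/-- Conjugation reverses the order of the factors, and the conjugate transpose reverses each step,
so the same cycle is run backwards from the same starting point. -/
theorem star_cycleProd_conjTranspose (M : Matrix ι ι ℍ[ℝ]) (σ : Perm ι) (s : ι) :
    star (cycleProd Mᴴ σ s) = cycleProd M σ⁻¹ s := by
  have hp : Function.minimalPeriod (σ⁻¹ : Perm ι) s = Function.minimalPeriod σ s :=
    minimalPeriod_congr_pow fun n => by
      rw [inv_pow, Perm.inv_eq_iff_eq, eq_comm]
  unfold cycleProd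
  rw [hp]
  set p := Function.minimalPeriod σ s with hpdef
  have hstar : ∀ l : List ℍ[ℝ], star l.prod = (l.reverse.map star).prod := by
    intro l
    induction l with
    | nil => simp
    | cons a l ih => simp [ih]
  rw [hstar, ← List.map_reverse, List.map_map]
  congr 1
  apply List.ext_getElem
  · simp
  · intro t h1 h2
    simp only [List.length_map, List.length_reverse, List.length_range] at h1 h2
    simp only [List.getElem_map, List.getElem_reverse, List.length_range, List.getElem_range,
      Function.comp, Matrix.conjTranspose_apply, star_star]
    have hinv : ∀ t ≤ p, (σ⁻¹ ^ t) s = (σ ^ (p - t)) s := by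
      intro t ht
      rw [inv_pow, Perm.inv_eq_iff_eq, ← Perm.mul_apply, ← pow_add,
        show t + (p - t) = p by omega]
      exact (pow_minimalPeriod_apply σ s).symm
    rw [hinv t h2.le, hinv (t + 1) h2]
    congr 3 <;> omega

theorem leaders_inv (σ : Perm ι) (j : ι) : leaders σ⁻¹ j = leaders σ j := by
  unfold leaders
  simp only [sameCycle_inv]

/-- A permutation and its inverse have the same cycles, hence the same leaders and sign, while
conjugation reverses the order of the cycles. This reduces all column statements to row statements.
-/
theorem cdet_eq_star_rdet (M : Matrix ι ι ℍ[ℝ]) (j : ι) : cdet j M = star (rdet j Mᴴ) := by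
  unfold cdet rdet
  rw [star_sum]
  refine Fintype.sum_equiv (Equiv.inv (Perm ι)) _ _ fun σ => ?_
  simp only [Equiv.inv_apply, leaders_inv]
  have hstar : ∀ l : List ι, star (l.map (cycleProd Mᴴ σ⁻¹)).prod =
      (l.reverse.map (cycleProd M σ)).prod := by
    intro l
    induction l with
    | nil => simp
    | cons a l ih => simp [ih, star_cycleProd_conjTranspose]
  rw [star_mul, star_mul, hstar, star_cycleProd_conjTranspose, inv_inv]
  rcases neg_one_pow_eq_or ℍ[ℝ] (Fintype.card ι - ((leaders σ j).length + 1)) with h | h <;>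
    rw [h] <;> simp

end PermDeterminants

/-! ### Principal minors and cofactors of Hermitian matrices. -/

section HermitianMinors

variable {ι : Type*} [Fintype ι] [LinearOrder ι]

theorem commute_of_star_eq {x : ℍ[ℝ]} (h : star x = x) (y : ℍ[ℝ]) : x * y = y * x := by
  rw [Quaternion.star_eq_self] at h
  rw [h]
  exact Quaternion.coe_commutes _ _

/-- The coefficient of `b i` in the row determinant on `α` whose `j`-th row is replaced
with `b`. -/
noncomputable def cofIn (B : Matrix ι ι ℍ[ℝ]) (α : Finset ι) (i j : ι) : ℍ[ℝ] :=
  if i = j then minorIn (α.erase j) B else -rdetIn (α.erase i) j (B.updateRow j (B i))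

theorem cofIn_self (B : Matrix ι ι ℍ[ℝ]) (α : Finset ι) (j : ι) :
    cofIn B α j j = minorIn (α.erase j) B := if_pos rfl

theorem rdetIn_updateRow_eq_sum {α : Finset ι} {j : ι} (hj : j ∈ α) (B : Matrix ι ι ℍ[ℝ])
    (b : ι → ℍ[ℝ]) : rdetIn α j (B.updateRow j b) = ∑ i ∈ α, b i * cofIn B α i j := by
  rw [rdetIn_updateRow hj, ← Finset.add_sum_erase α _ hj, cofIn_self]
  congr 1
  refine Finset.sum_congr rfl fun i hi => ?_
  rw [cofIn, if_neg (Finset.mem_erase.mp hi).1, mul_neg]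

theorem rdetIn_eq_sum {α : Finset ι} {j : ι} (hj : j ∈ α) (B : Matrix ι ι ℍ[ℝ]) :
    rdetIn α j B = ∑ i ∈ α, B j i * cofIn B α i j := by
  rw [← rdetIn_updateRow_eq_sum hj, Matrix.updateRow_eq_self]

theorem cofIn_of_ne {α : Finset ι} {i j : ι} (hj : j ∈ α) (hij : i ≠ j) (B : Matrix ι ι ℍ[ℝ]) :
    cofIn B α i j = -∑ l ∈ α.erase i, B i l * cofIn B (α.erase i) l j := by
  rw [cofIn, if_neg hij, rdetIn_updateRow_eq_sum (Finset.mem_erase.mpr ⟨hij.symm, hj⟩)]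

/-- The properties shared by the principal minors of a Hermitian matrix: the minor on `α` is
real and does not depend on the expanding row, and the cofactors form a Hermitian adjugate. -/
structure IsAdjugateOn (B : Matrix ι ι ℍ[ℝ]) (α : Finset ι) : Prop where
  star_minor : star (minorIn α B) = minorIn α B
  rdet_eq : ∀ j ∈ α, rdetIn α j B = minorIn α B
  star_cof : ∀ i ∈ α, ∀ j ∈ α, star (cofIn B α i j) = cofIn B α j i
  cof_last : ∀ i ∈ α, ∀ j ∈ α, i ≠ j →
    cofIn B α i j = -∑ l ∈ α.erase j, cofIn B (α.erase j) i l * B l j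
  cof_mul : ∀ i ∈ α, ∀ j ∈ α,
    ∑ l ∈ α, cofIn B α i l * B l j = if i = j then minorIn α B else 0

variable {B : Matrix ι ι ℍ[ℝ]} {α : Finset ι}

/-- Peel off the first step from `i` on the left and the last step into `j` on the right. Both sides
become the direct term, `B i j` times the minor without `i` and `j`, and the same double sum over
cofactors of that smaller set. The direct terms agree because the minor is real, hence central. -/
theorem cofIn_last (IH : ∀ γ ⊂ α, IsAdjugateOn B γ) {i j : ι} (hi : i ∈ α) (hj : j ∈ α)
    (hij : i ≠ j) :
    cofIn B α i j = -∑ l ∈ α.erase j, cofIn B (α.erase j) i l * B l j := by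
  have hji : j ∈ α.erase i := Finset.mem_erase.mpr ⟨hij.symm, hj⟩
  have hij' : i ∈ α.erase j := Finset.mem_erase.mpr ⟨hij, hi⟩
  rw [cofIn_of_ne hj hij, ← Finset.add_sum_erase _ _ hji, ← Finset.add_sum_erase _ _ hij',
    cofIn_self, cofIn_self, Finset.erase_right_comm (a := j) (b := i)]
  have hsub : (α.erase i).erase j ⊂ α :=
    (Finset.erase_ssubset hji).trans (Finset.erase_ssubset hi)
  rw [commute_of_star_eq (IH _ hsub).star_minor (B i j)]
  congr 2
  have h1 : ∀ l ∈ (α.erase i).erase j, B i l * cofIn B (α.erase i) l j =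
      -∑ h ∈ (α.erase i).erase j, B i l * cofIn B ((α.erase i).erase j) l h * B h j := by
    intro l hl
    obtain ⟨hlj, hli⟩ := Finset.mem_erase.mp hl
    rw [(IH _ (Finset.erase_ssubset hi)).cof_last l hli j hji hlj, mul_neg, Finset.mul_sum]
    simp only [mul_assoc]
  have h2 : ∀ h ∈ (α.erase i).erase j, cofIn B (α.erase j) i h * B h j =
      -∑ l ∈ (α.erase i).erase j, B i l * cofIn B ((α.erase i).erase j) l h * B h j := by
    intro h hh
    obtain ⟨hhj, hhi⟩ := Finset.mem_erase.mp hh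
    rw [cofIn_of_ne (Finset.mem_erase.mpr ⟨hhj, (Finset.mem_erase.mp hhi).2⟩)
      (Finset.mem_erase.mp hhi).1.symm, neg_mul, Finset.sum_mul,
      Finset.erase_right_comm (a := j) (b := i)]
  rw [Finset.sum_congr rfl h1, Finset.sum_congr rfl h2, Finset.sum_neg_distrib,
    Finset.sum_neg_distrib, Finset.sum_comm]

theorem star_apply_of_hermitian (hB : Bᴴ = B) (i j : ι) : star (B i j) = B j i := by
  rw [← Matrix.conjTranspose_apply, hB]

/-- Conjugation exchanges the recursion on the first index with the one on the last index. -/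
theorem star_cofIn (hB : Bᴴ = B) (IH : ∀ γ ⊂ α, IsAdjugateOn B γ)
    {i j : ι} (hi : i ∈ α) (hj : j ∈ α) :
    star (cofIn B α i j) = cofIn B α j i := by
  by_cases hij : i = j
  · subst hij
    rw [cofIn_self]
    exact (IH _ (Finset.erase_ssubset hi)).star_minor
  · rw [cofIn_of_ne hj hij, cofIn_last IH hj hi (Ne.symm hij), star_neg, star_sum]
    congr 1
    refine Finset.sum_congr rfl fun l hl => ?_
    rw [star_mul, star_apply_of_hermitian hB, (IH _ (Finset.erase_ssubset hi)).star_cof l hl j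
      (Finset.mem_erase.mpr ⟨Ne.symm hij, hj⟩)]

/-- After expansion in the first index, the adjugate identity on `α.erase i` leaves only the term `B
i j` times its minor, which cancels the diagonal term. -/
theorem cofIn_mul_of_ne (IH : ∀ γ ⊂ α, IsAdjugateOn B γ) {i j : ι} (hi : i ∈ α) (hj : j ∈ α)
    (hij : i ≠ j) : ∑ l ∈ α, cofIn B α i l * B l j = 0 := by
  have hα := IH _ (Finset.erase_ssubset hi)
  have hji : j ∈ α.erase i := Finset.mem_erase.mpr ⟨hij.symm, hj⟩
  rw [← Finset.add_sum_erase _ _ hi, cofIn_self]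
  have h1 : ∀ l ∈ α.erase i, cofIn B α i l * B l j =
      -∑ h ∈ α.erase i, B i h * (cofIn B (α.erase i) h l * B l j) := by
    intro l hl
    obtain ⟨hli, hlα⟩ := Finset.mem_erase.mp hl
    rw [cofIn_of_ne hlα (Ne.symm hli), neg_mul, Finset.sum_mul]
    simp only [mul_assoc]
  rw [Finset.sum_congr rfl h1, Finset.sum_neg_distrib, Finset.sum_comm]
  simp only [← Finset.mul_sum]
  rw [Finset.sum_congr rfl fun h hh => by rw [hα.cof_mul h hh j hji]]
  simp only [mul_ite, mul_zero]
  rw [Finset.sum_ite_eq' _ j, if_pos hji, commute_of_star_eq hα.star_minor, add_neg_cancel]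

/-- Expanding at both ends gives a real diagonal term minus a Hermitian form in the cofactors of
`α.erase j`, evaluated on row `j` and column `j` of `B`. -/
theorem star_rdetIn (hB : Bᴴ = B) (IH : ∀ γ ⊂ α, IsAdjugateOn B γ) {j : ι} (hj : j ∈ α) :
    star (rdetIn α j B) = rdetIn α j B := by
  have hα := IH _ (Finset.erase_ssubset hj)
  have h1 : rdetIn α j B = B j j * minorIn (α.erase j) B -
      ∑ i ∈ α.erase j, ∑ l ∈ α.erase j, B j i * cofIn B (α.erase j) i l * B l j := by
    rw [rdetIn_eq_sum hj, ← Finset.add_sum_erase _ _ hj, cofIn_self, sub_eq_add_neg,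
      ← Finset.sum_neg_distrib]
    congr 1
    refine Finset.sum_congr rfl fun i hi => ?_
    obtain ⟨hij, hiα⟩ := Finset.mem_erase.mp hi
    rw [cofIn_last IH hiα hj hij, mul_neg, Finset.mul_sum]
    simp only [mul_assoc]
  rw [h1, star_sub, star_mul, hα.star_minor, star_apply_of_hermitian hB,
    commute_of_star_eq hα.star_minor, star_sum]
  congr 1
  rw [Finset.sum_comm]
  refine Finset.sum_congr rfl fun l hl => ?_
  rw [star_sum]
  refine Finset.sum_congr rfl fun i hi => ?_
  rw [star_mul, star_mul, star_apply_of_hermitian hB, star_apply_of_hermitian hB,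
    hα.star_cof l hl i hi, mul_assoc]

theorem cofIn_mul_self (hB : Bᴴ = B) (IH : ∀ γ ⊂ α, IsAdjugateOn B γ) {j : ι} (hj : j ∈ α) :
    ∑ l ∈ α, cofIn B α j l * B l j = rdetIn α j B := by
  rw [← star_rdetIn hB IH hj, rdetIn_eq_sum hj, star_sum]
  refine Finset.sum_congr rfl fun l hl => ?_
  rw [star_mul, star_apply_of_hermitian hB, star_cofIn hB IH hl hj]

/-- Evaluating the `(i, j)` entry of `B`, cofactors, `B` with either bracketing gives `B i j` times
the determinant at `j` or the determinant at `i` times `B i j`. These are real, so the nonzero entry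
cancels. -/
theorem rdetIn_eq_of_entry_ne_zero (hB : Bᴴ = B) (IH : ∀ γ ⊂ α, IsAdjugateOn B γ)
    {i j : ι} (hi : i ∈ α)
    (hj : j ∈ α) (h : B i j ≠ 0) : rdetIn α i B = rdetIn α j B := by
  have hcm : ∀ x ∈ α, ∀ y ∈ α, ∑ l ∈ α, cofIn B α x l * B l y =
      if x = y then rdetIn α x B else 0 := by
    intro x hx y hy
    split_ifs with hxy
    · subst hxy; exact cofIn_mul_self hB IH hx
    · exact cofIn_mul_of_ne IH hx hy hxy
  have hmc : ∀ x ∈ α, ∀ y ∈ α, ∑ l ∈ α, B x l * cofIn B α l y =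
      if x = y then rdetIn α x B else 0 := by
    intro x hx y hy
    have hst : ∑ l ∈ α, B x l * cofIn B α l y = star (∑ l ∈ α, cofIn B α y l * B l x) := by
      rw [star_sum]
      refine Finset.sum_congr rfl fun l hl => ?_
      rw [star_mul, star_apply_of_hermitian hB, star_cofIn hB IH hy hl]
    rw [hst, hcm y hy x hx]
    split_ifs with h1 h2 h2
    · subst h1; exact star_rdetIn hB IH hy
    · exact absurd h1.symm h2
    · exact absurd h2.symm h1
    · simp
  have h1 : ∑ x ∈ α, ∑ y ∈ α, B i x * cofIn B α x y * B y j = B i j * rdetIn α j B := by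
    simp only [mul_assoc, ← Finset.mul_sum]
    rw [Finset.sum_congr rfl fun x hx => by rw [hcm x hx j hj]]
    rw [← Finset.add_sum_erase _ _ hj, if_pos rfl, Finset.sum_eq_zero, add_zero]
    intro x hx
    rw [if_neg (Finset.mem_erase.mp hx).1, mul_zero]
  have h2 : ∑ x ∈ α, ∑ y ∈ α, B i x * cofIn B α x y * B y j = rdetIn α i B * B i j := by
    rw [Finset.sum_comm]
    simp only [← Finset.sum_mul]
    rw [Finset.sum_congr rfl fun y hy => by rw [hmc i hi y hy]]
    rw [← Finset.add_sum_erase _ _ hi, if_pos rfl, Finset.sum_eq_zero, add_zero]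
    intro y hy
    rw [if_neg (Finset.mem_erase.mp hy).1.symm, zero_mul]
  have h3 : B i j * rdetIn α i B = B i j * rdetIn α j B := by
    rw [← h1, h2, commute_of_star_eq (star_rdetIn hB IH hi)]
  exact mul_left_cancel₀ h h3

theorem continuous_rdetIn {f : ℝ → Matrix ι ι ℍ[ℝ]} (hf : Continuous f) (α : Finset ι) (j : ι) :
    Continuous fun t => rdetIn α j (f t) := by
  have hc : ∀ (σ : Equiv.Perm ι) (s : ι), Continuous fun t => cycleProd (f t) σ s := by
    intro σ s
    unfold cycleProd
    refine continuous_list_prod _ fun x _ => ?_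
    exact hf.matrix_elem _ _
  unfold rdetIn rdetTerm
  refine continuous_finsetSum _ fun σ _ => continuous_const.mul ((hc σ j).mul ?_)
  exact continuous_list_prod _ fun s _ => hc σ s

/-- A vanishing entry is reached by continuity from Hermitian perturbations of `B`; the induction
hypothesis must therefore cover all Hermitian matrices. -/
theorem rdetIn_eq_rdetIn (hB : Bᴴ = B)
    (IH : ∀ γ ⊂ α, ∀ M : Matrix ι ι ℍ[ℝ], Mᴴ = M → IsAdjugateOn M γ) {i j : ι} (hi : i ∈ α)
    (hj : j ∈ α) : rdetIn α i B = rdetIn α j B := by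
  by_cases hij : i = j
  · rw [hij]
  by_cases h0 : B i j = 0
  swap
  · exact rdetIn_eq_of_entry_ne_zero hB (fun γ hγ => IH γ hγ B hB) hi hj h0
  -- Since `B i j = 0`, the entry of `B + t • E` at `(i, j)` is `t`, nonzero on a dense set of
  -- parameters.
  let E : Matrix ι ι ℍ[ℝ] := Matrix.single i j 1 + Matrix.single j i 1
  have hE : Eᴴ = E := by
    simp [E, Matrix.conjTranspose_add, Matrix.conjTranspose_single, add_comm]
  have hEij : E i j = 1 := by
    simp [E, Matrix.single, Ne.symm hij]
  let f : ℝ → Matrix ι ι ℍ[ℝ] := fun t => B + t • E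
  have hf : Continuous f := by
    exact continuous_const.add (continuous_id.smul continuous_const)
  have hfun : (fun t => rdetIn α i (f t)) = fun t => rdetIn α j (f t) := by
    refine (continuous_rdetIn hf α i).ext_on (dense_compl_singleton (0 : ℝ))
      (continuous_rdetIn hf α j) fun t ht => ?_
    have hft : (f t)ᴴ = f t := by
      ext1 x y
      have hx := congrFun (congrFun hE x) y
      have hb := congrFun (congrFun hB x) y
      rw [Matrix.conjTranspose_apply] at hx hb
      simp only [f, Matrix.conjTranspose_apply, Matrix.add_apply, Matrix.smul_apply, star_add,
        Quaternion.star_smul, hx, hb]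
    refine rdetIn_eq_of_entry_ne_zero hft (fun γ hγ => IH γ hγ _ hft) hi hj ?_
    simp only [f, Matrix.add_apply, h0, Matrix.smul_apply, hEij, zero_add]
    exact smul_ne_zero ht one_ne_zero
  simpa [f] using congrFun hfun 0

theorem isAdjugateOn_of_hermitian (α : Finset ι) :
    ∀ B : Matrix ι ι ℍ[ℝ], Bᴴ = B → IsAdjugateOn B α := by
  induction α using Finset.strongInduction with
  | H α IH =>
    intro B hB
    have IHB : ∀ γ ⊂ α, IsAdjugateOn B γ := fun γ hγ => IH γ hγ B hB
    have hdiag : ∀ j ∈ α, rdetIn α j B = minorIn α B := by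
      intro j hj
      rw [minorIn, dif_pos ⟨j, hj⟩]
      exact rdetIn_eq_rdetIn hB IH hj (Finset.min'_mem _ _)
    refine ⟨?_, hdiag, fun i hi j hj => star_cofIn hB IHB hi hj,
      fun i hi j hj hij => cofIn_last IHB hi hj hij, fun i hi j hj => ?_⟩
    · by_cases h : α.Nonempty
      · rw [← hdiag _ h.choose_spec]
        exact star_rdetIn hB IHB h.choose_spec
      · rw [minorIn, dif_neg h, star_one]
    · split_ifs with hij
      · subst hij
        rw [cofIn_mul_self hB IHB hi, hdiag i hi]
      · exact cofIn_mul_of_ne IHB hi hj hij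

end HermitianMinors

/-! ### Sums of minors, the Faddeev–LeVerrier recursion and traces. -/

section SumsOfMinors

variable {ι : Type*} [Fintype ι] [LinearOrder ι]

theorem rdetSum_eq_sum (q : ℕ) (B : Matrix ι ι ℍ[ℝ]) (j : ι) (b : ι → ℍ[ℝ]) :
    rdetSum q B j b = ∑ α ∈ Finset.univ.powersetCard q with j ∈ α,
      ∑ i ∈ α, b i * cofIn B α i j := by
  rw [rdetSum, Finset.sum_subtype _ (p := fun α : Finset ι => α.card = q ∧ j ∈ α)
    (fun α => by simp [Finset.mem_powersetCard])]
  refine Finset.sum_congr rfl fun α _ => ?_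
  rw [rdet_principal, rdetIn_updateRow_eq_sum α.2.2]

theorem minorSum_eq_sum (q : ℕ) (B : Matrix ι ι ℍ[ℝ]) :
    minorSum q B = ∑ α ∈ Finset.univ.powersetCard q, minorIn α B := by
  rw [minorSum, Finset.sum_subtype _ (p := fun α : Finset ι => α.card = q)
    (fun α => by simp [Finset.mem_powersetCard])]
  refine Finset.sum_congr rfl fun α _ => ?_
  rw [hdet_principal]

theorem minorSum_zero (B : Matrix ι ι ℍ[ℝ]) : minorSum 0 B = 1 := by
  simp [minorSum_eq_sum, minorIn]

theorem minorSum_of_card_lt {q : ℕ} (hq : Fintype.card ι < q) (B : Matrix ι ι ℍ[ℝ]) :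
    minorSum q B = 0 := by
  rw [minorSum_eq_sum, Finset.powersetCard_eq_empty.mpr (by simpa using hq), Finset.sum_empty]

theorem rdetSum_of_card_lt {q : ℕ} (hq : Fintype.card ι < q) (B : Matrix ι ι ℍ[ℝ]) (j : ι)
    (b : ι → ℍ[ℝ]) : rdetSum q B j b = 0 := by
  rw [rdetSum_eq_sum, Finset.powersetCard_eq_empty.mpr (by simpa using hq)]
  simp

theorem rdetSum_zero (B : Matrix ι ι ℍ[ℝ]) (j : ι) (b : ι → ℍ[ℝ]) : rdetSum 0 B j b = 0 := by
  rw [rdetSum_eq_sum, Finset.sum_eq_zero]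
  intro α hα
  simp only [Finset.mem_filter, Finset.mem_powersetCard_univ, Finset.card_eq_zero] at hα
  simp [hα.1]

variable {B : Matrix ι ι ℍ[ℝ]}

theorem star_minorSum (hB : Bᴴ = B) (q : ℕ) : star (minorSum q B) = minorSum q B := by
  rw [minorSum_eq_sum, star_sum]
  exact Finset.sum_congr rfl fun α _ => (isAdjugateOn_of_hermitian α B hB).star_minor

theorem minorSum_eq_coe (hB : Bᴴ = B) (q : ℕ) : minorSum q B = ((minorSum q B).re : ℍ[ℝ]) :=
  Quaternion.star_eq_self.mp (star_minorSum hB q)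

theorem sum_cofIn_insert (hB : Bᴴ = B) {α : Finset ι} {j : ι} (hj : j ∉ α) (b : ι → ℍ[ℝ]) :
    ∑ i ∈ insert j α, b i * cofIn B (insert j α) i j =
      b j * minorIn α B - ∑ l ∈ α, (∑ i ∈ α, b i * cofIn B α i l) * B l j := by
  rw [Finset.sum_insert hj, cofIn_self, Finset.erase_insert hj, sub_eq_add_neg,
    ← Finset.sum_neg_distrib]
  congr 1
  simp only [Finset.sum_mul, ← Finset.sum_neg_distrib]
  rw [Finset.sum_comm]
  refine Finset.sum_congr rfl fun i hi => ?_
  rw [(isAdjugateOn_of_hermitian (insert j α) B hB).cof_last i (Finset.mem_insert_of_mem hi) j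
    (Finset.mem_insert_self j α) (fun h => hj (h ▸ hi)), Finset.erase_insert hj, mul_neg,
    Finset.mul_sum, ← Finset.sum_neg_distrib]
  simp only [mul_assoc]

/-- The recursion of Faddeev–LeVerrier type for the sums of row determinants. -/
theorem rdetSum_succ_add (hB : Bᴴ = B) (q : ℕ) (j : ι) (b : ι → ℍ[ℝ]) :
    rdetSum (q + 1) B j b + ∑ i, rdetSum q B i b * B i j = minorSum q B * b j := by
  have h1 : rdetSum (q + 1) B j b = ∑ α ∈ Finset.univ.powersetCard q with j ∉ α,
      (b j * minorIn α B - ∑ l ∈ α, (∑ i ∈ α, b i * cofIn B α i l) * B l j) := by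
    rw [rdetSum_eq_sum]
    symm
    refine Finset.sum_bij' (fun α _ => insert j α) (fun α _ => α.erase j) ?_ ?_ ?_ ?_ ?_
    · intro α hα
      simp only [Finset.mem_filter, Finset.mem_powersetCard_univ] at hα ⊢
      exact ⟨by rw [Finset.card_insert_of_notMem hα.2, hα.1], Finset.mem_insert_self _ _⟩
    · intro α hα
      simp only [Finset.mem_filter, Finset.mem_powersetCard_univ] at hα ⊢
      refine ⟨?_, Finset.notMem_erase _ _⟩
      rw [Finset.card_erase_of_mem hα.2, hα.1, Nat.add_sub_cancel]
    · intro α hα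
      exact Finset.erase_insert (Finset.mem_filter.mp hα).2
    · intro α hα
      exact Finset.insert_erase (Finset.mem_filter.mp hα).2
    · intro α hα
      exact (sum_cofIn_insert hB (Finset.mem_filter.mp hα).2 b).symm
  have h2 : ∑ i, rdetSum q B i b * B i j = ∑ α ∈ Finset.univ.powersetCard q,
      ∑ l ∈ α, (∑ i ∈ α, b i * cofIn B α i l) * B l j := by
    simp only [rdetSum_eq_sum, Finset.sum_filter, Finset.sum_mul, ite_mul, zero_mul]
    rw [Finset.sum_comm]
    refine Finset.sum_congr rfl fun α _ => ?_
    rw [Finset.sum_ite_mem, Finset.univ_inter]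
  -- For sets containing `j` the adjugate identity yields the minor at once. For sets avoiding `j`
  -- the same double sum cancels against the negative part in `h1`.
  have h3 : ∀ α : Finset ι, j ∈ α → ∑ l ∈ α, (∑ i ∈ α, b i * cofIn B α i l) * B l j =
      b j * minorIn α B := by
    intro α hj
    simp only [Finset.sum_mul, mul_assoc]
    rw [Finset.sum_comm]
    simp only [← Finset.mul_sum]
    rw [Finset.sum_congr rfl fun i hi => by
      rw [(isAdjugateOn_of_hermitian α B hB).cof_mul i hi j hj]]
    simp only [mul_ite, mul_zero]
    rw [Finset.sum_ite_eq' _ j, if_pos hj]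
  rw [h1, h2, minorSum_eq_sum,
    ← Finset.sum_filter_add_sum_filter_not (Finset.univ.powersetCard q) (fun α => j ∉ α),
    ← add_assoc, ← Finset.sum_add_distrib, Finset.sum_mul,
    ← Finset.sum_filter_add_sum_filter_not (Finset.univ.powersetCard q) (fun α => j ∉ α)]
  have hcomm : ∀ α, minorIn α B * b j = b j * minorIn α B := fun α =>
    commute_of_star_eq (isAdjugateOn_of_hermitian α B hB).star_minor _
  congr 1
  · refine Finset.sum_congr rfl fun α _ => ?_
    rw [sub_add_cancel, hcomm]
  · refine Finset.sum_congr rfl fun α hα => ?_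
    rw [h3 α (not_not.mp (Finset.mem_filter.mp hα).2), hcomm]

/-- Each set of size `q` is counted once for each of its elements, always with the same minor. -/
theorem sum_rdetSum_row (hB : Bᴴ = B) (q : ℕ) :
    ∑ j, rdetSum q B j (B j) = (q : ℍ[ℝ]) * minorSum q B := by
  simp only [rdetSum_eq_sum, Finset.sum_filter]
  rw [Finset.sum_comm, minorSum_eq_sum, Finset.mul_sum]
  refine Finset.sum_congr rfl fun α hα => ?_
  rw [Finset.sum_ite_mem, Finset.univ_inter, Finset.sum_congr rfl fun j hj => by
    rw [← rdetIn_eq_sum hj, (isAdjugateOn_of_hermitian α B hB).rdet_eq j hj], Finset.sum_const,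
    (Finset.mem_powersetCard.mp hα).2, nsmul_eq_mul]

/-- The matrix which represents `b ↦ rdetSum q B · b`. -/
noncomputable def adjCoef (B : Matrix ι ι ℍ[ℝ]) : ℕ → Matrix ι ι ℍ[ℝ]
  | 0 => 0
  | q + 1 => (minorSum q B).re • (1 : Matrix ι ι ℍ[ℝ]) - adjCoef B q * B

/-- The recursion is linear in `b` from the left, and the sum of minors, being real, can be moved to
the right of `b`. -/
theorem rdetSum_eq_vecMul (hB : Bᴴ = B) (q : ℕ) (j : ι) (b : ι → ℍ[ℝ]) :
    rdetSum q B j b = Matrix.vecMul b (adjCoef B q) j := by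
  induction q generalizing j with
  | zero => simp [rdetSum_zero, adjCoef]
  | succ q ih =>
    have h := rdetSum_succ_add hB q j b
    simp only [ih] at h
    rw [eq_sub_of_add_eq h, adjCoef, Matrix.vecMul_sub, ← Matrix.vecMul_vecMul, Pi.sub_apply]
    congr 1
    rw [minorSum_eq_coe hB q, Quaternion.coe_commutes]
    simp only [Matrix.vecMul, dotProduct, Matrix.smul_apply, Matrix.one_apply, Quaternion.re_coe]
    rw [Finset.sum_eq_single j (fun i _ hi => by simp [hi]) (by simp), if_pos rfl,
      mul_smul_comm, mul_one, ← Quaternion.coe_mul_eq_smul, Quaternion.coe_commutes]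

theorem commute_adjCoef (B : Matrix ι ι ℍ[ℝ]) (q : ℕ) : Commute (adjCoef B q) B := by
  induction q with
  | zero => exact Commute.zero_left B
  | succ q ih =>
    exact ((Commute.one_left B).smul_left _).sub_left (ih.mul_left (Commute.refl B))

theorem conjTranspose_real_smul {κ μ : Type*} (c : ℝ) (M : Matrix κ μ ℍ[ℝ]) :
    (c • M)ᴴ = c • Mᴴ := by
  ext1 i j
  simp only [Matrix.conjTranspose_apply, Matrix.smul_apply, Quaternion.star_smul]

theorem conjTranspose_adjCoef (hB : Bᴴ = B) (q : ℕ) : (adjCoef B q)ᴴ = adjCoef B q := by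
  induction q with
  | zero => exact Matrix.conjTranspose_zero
  | succ q ih =>
    rw [adjCoef, Matrix.conjTranspose_sub, conjTranspose_real_smul, Matrix.conjTranspose_one,
      Matrix.conjTranspose_mul, ih, hB, (commute_adjCoef B q).eq]

theorem adjCoef_of_card_lt (hB : Bᴴ = B) {q : ℕ} (hq : Fintype.card ι < q) :
    adjCoef B q = 0 := by
  ext1 i j
  have h := rdetSum_eq_vecMul hB q j (Pi.single i 1)
  rw [rdetSum_of_card_lt hq, Matrix.single_one_vecMul] at h
  exact h.symm

/-! #### The real trace -/

theorem re_finset_sum {κ : Type*} (s : Finset κ) (f : κ → ℍ[ℝ]) :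
    (∑ i ∈ s, f i).re = ∑ i ∈ s, (f i).re := by
  classical
  induction s using Finset.induction_on with
  | empty => rfl
  | insert a s ha ih => rw [Finset.sum_insert ha, Finset.sum_insert ha, Quaternion.re_add, ih]

/-- The real part of the trace. -/
noncomputable def reTrace {κ : Type*} [Fintype κ] (M : Matrix κ κ ℍ[ℝ]) : ℝ :=
  (Matrix.trace M).re

theorem reTrace_eq_sum {κ : Type*} [Fintype κ] (M : Matrix κ κ ℍ[ℝ]) :
    reTrace M = ∑ i, (M i i).re := by
  rw [reTrace, Matrix.trace, re_finset_sum]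
  rfl

/-- Over the quaternions only the real part of a product is insensitive to the order of the factors;
hence the use of real traces. -/
theorem reTrace_mul_comm {κ μ : Type*} [Fintype κ] [Fintype μ] (M : Matrix κ μ ℍ[ℝ])
    (N : Matrix μ κ ℍ[ℝ]) : reTrace (M * N) = reTrace (N * M) := by
  have h : ∀ x y : ℍ[ℝ], (x * y).re = (y * x).re := by
    intro x y
    simp only [Quaternion.re_mul]
    ring
  simp only [reTrace_eq_sum, Matrix.mul_apply]
  simp only [re_finset_sum]
  rw [Finset.sum_comm]
  simp only [h]

theorem reTrace_real_smul {κ : Type*} [Fintype κ] (c : ℝ) (M : Matrix κ κ ℍ[ℝ]) :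
    reTrace (c • M) = c * reTrace M := by
  simp [reTrace_eq_sum, Finset.mul_sum]

theorem reTrace_mul_adjCoef (hB : Bᴴ = B) (q : ℕ) :
    reTrace (B * adjCoef B q) = q * (minorSum q B).re := by
  have h := congrArg QuaternionAlgebra.re (sum_rdetSum_row hB q)
  simp only [rdetSum_eq_vecMul hB] at h
  have h2 : ((q : ℍ[ℝ]) * minorSum q B).re = q * (minorSum q B).re := by
    rw [← nsmul_eq_mul]
    simp
  rw [← h2, ← h]
  rfl

/-- The sums of principal minors of `A Aᴴ` and `Aᴴ A` agree. -/
theorem minorSum_mul_conjTranspose {κ : Type*} [Fintype κ] [LinearOrder κ] (A : Matrix ι κ ℍ[ℝ])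
    (q : ℕ) : minorSum q (A * Aᴴ) = minorSum q (Aᴴ * A) := by
  have hB : (A * Aᴴ)ᴴ = A * Aᴴ := by simp [Matrix.conjTranspose_mul]
  have hB' : (Aᴴ * A)ᴴ = Aᴴ * A := by simp [Matrix.conjTranspose_mul]
  induction q using Nat.strong_induction_on with
  | _ q ih =>
    -- The coefficient matrix of index `p` involves only sums of minors of order below `p`, so the
    -- induction hypothesis suffices even for `p = q`. The trace formula then settles order `q`.
    have hint : ∀ p ≤ q, Aᴴ * adjCoef (A * Aᴴ) p = adjCoef (Aᴴ * A) p * Aᴴ := by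
      intro p
      induction p with
      | zero => intro _; simp [adjCoef]
      | succ p ihp =>
        intro hp
        rw [adjCoef, adjCoef, ih p hp, Matrix.mul_sub, Matrix.sub_mul, ← Matrix.mul_assoc,
          ihp (by omega)]
        simp only [Matrix.mul_smul, Matrix.smul_mul, Matrix.mul_one, Matrix.one_mul,
          Matrix.mul_assoc]
    rcases Nat.eq_zero_or_pos q with rfl | hq
    · rw [minorSum_zero, minorSum_zero]
    · rw [minorSum_eq_coe hB, minorSum_eq_coe hB']
      congr 1
      have h1 := reTrace_mul_adjCoef hB q
      have h2 := reTrace_mul_adjCoef hB' q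
      rw [Matrix.mul_assoc, hint q le_rfl, reTrace_mul_comm, Matrix.mul_assoc,
        ← (commute_adjCoef (Aᴴ * A) q).eq.symm, h2] at h1
      have hq' : (q : ℝ) ≠ 0 := by exact_mod_cast hq.ne'
      exact (mul_left_cancel₀ hq' h1).symm

end SumsOfMinors

/-! ### Rank and real trace of idempotents. -/

section RankTrace

variable {ι : Type*} [Fintype ι] [DecidableEq ι]

/-- The real trace of an idempotent quaternion matrix is its rank. -/
theorem reTrace_of_idempotent {E : Matrix ι ι ℍ[ℝ]} (hE : E * E = E) : reTrace E = rk E := by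
  -- Rank factorization `E = X * Y`: the rows of `Y` are a basis of the row space and `X` holds the
  -- coordinates. Idempotency gives `Y * E = Y`, and independence of the rows then gives `Y * X =
  -- 1`, of size `rk E`.
  let S := Submodule.span ℍ[ℝ] (Set.range E.row)
  let b := Module.finBasis ℍ[ℝ] S
  let Y : Matrix (Fin (rk E)) ι ℍ[ℝ] := Matrix.of fun k => (b k : ι → ℍ[ℝ])
  have hrow : ∀ i, E.row i ∈ S := fun i => Submodule.subset_span ⟨i, rfl⟩
  let X : Matrix ι (Fin (rk E)) ℍ[ℝ] := Matrix.of fun i k => b.repr ⟨E.row i, hrow i⟩ k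
  have hXY : X * Y = E := by
    ext1 i j
    have h := congrArg (fun v : S => (v : ι → ℍ[ℝ]) j) (b.sum_repr ⟨E.row i, hrow i⟩)
    simp only [Submodule.coe_sum, Submodule.coe_smul, Finset.sum_apply, Pi.smul_apply,
      smul_eq_mul] at h
    rw [Matrix.mul_apply]
    exact h
  have hYE : Y * E = Y := by
    ext1 k j
    obtain ⟨c, hc⟩ := (mem_rowSpace_iff E _).mp (b k).2
    have h1 : Matrix.vecMul (b k : ι → ℍ[ℝ]) E = b k := by
      rw [← hc, Matrix.vecMul_vecMul, hE]
    exact congrFun h1 j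
  have hlin : LinearIndependent ℍ[ℝ] fun k => (b k : ι → ℍ[ℝ]) :=
    b.linearIndependent.map' S.subtype (Submodule.ker_subtype S)
  have hYX : Y * X = 1 := by
    have h0 : (Y * X - 1) * Y = 0 := by
      rw [Matrix.sub_mul, Matrix.mul_assoc, hXY, hYE, Matrix.one_mul, sub_self]
    rw [← sub_eq_zero]
    ext1 k l
    have h1 : ∑ l, (Y * X - 1 : Matrix (Fin (rk E)) (Fin (rk E)) ℍ[ℝ]) k l • (b l
        : ι → ℍ[ℝ]) = 0 := by
      ext1 j
      have := congrFun (congrFun h0 k) j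
      rw [Matrix.mul_apply] at this
      simpa [Finset.sum_apply, Y] using this
    exact Fintype.linearIndependent_iff.mp hlin _ h1 l
  rw [← hXY, reTrace_mul_comm, hYX, reTrace_eq_sum, hXY]
  simp

theorem rk_le_of_eq_mul {κ μ ν : Type*} [Fintype κ] [Fintype μ] [Fintype ν]
    {M : Matrix μ κ ℍ[ℝ]} {N : Matrix ν κ ℍ[ℝ]} (Z : Matrix μ ν ℍ[ℝ]) (h : M = Z * N) :
    rk M ≤ rk N := by
  rw [h]
  exact Submodule.finrank_mono (rowSpace_mul_le Z N)

end RankTrace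

/-! ### The last nonvanishing sum of minors, range projections and Moore–Penrose inverses. -/

section TopMinors

variable {ι κ : Type*} [Fintype ι] [LinearOrder ι] [Fintype κ] [LinearOrder κ]

/-- `s` is the largest order of a nonvanishing sum of principal minors. -/
def IsTopOrder (B : Matrix ι ι ℍ[ℝ]) (s : ℕ) : Prop :=
  minorSum s B ≠ 0 ∧ ∀ q, s < q → minorSum q B = 0

theorem exists_isTopOrder (B : Matrix ι ι ℍ[ℝ]) : ∃ s, IsTopOrder B s := by
  classical
  refine ⟨Nat.findGreatest (fun q => minorSum q B ≠ 0) (Fintype.card ι), ?_, fun q hq => ?_⟩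
  · exact Nat.findGreatest_spec (P := fun q => minorSum q B ≠ 0) (Nat.zero_le _)
      (by rw [minorSum_zero]; exact one_ne_zero)
  · by_cases h : q ≤ Fintype.card ι
    · exact not_not.mp (Nat.findGreatest_is_greatest hq h)
    · exact minorSum_of_card_lt (by omega) B

variable {B : Matrix ι ι ℍ[ℝ]} {s : ℕ}

theorem mul_eq_zero_of_pow_mul (hB : Bᴴ = B) (Y : Matrix ι ι ℍ[ℝ]) (i : ℕ) (h : B ^ i * Y = 0) :
    B * Y = 0 := by
  induction i generalizing Y with
  | zero => rw [pow_zero, one_mul] at h; rw [h, mul_zero]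
  | succ i ih =>
    rw [pow_succ, mul_assoc] at h
    apply mul_eq_zero_of_conjTranspose_mul
    rw [hB, mul_assoc]
    exact ih _ h

/-- Beyond order `s` the recursion only multiplies by `-B`, while the coefficients vanish once the
order exceeds the size. So a power of `B` kills `adjCoef B (s + 1)`; as `B` is Hermitian, `B` itself
already does. -/
theorem adjCoef_top_mul (hB : Bᴴ = B) (hs : IsTopOrder B s) :
    adjCoef B s * B * B = (minorSum s B).re • B := by
  have h1 : ∀ i, adjCoef B (s + 1 + i) = (-1) ^ i * (B ^ i * adjCoef B (s + 1)) := by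
    intro i
    induction i with
    | zero => simp
    | succ i ih =>
      rw [← add_assoc, adjCoef, hs.2 (s + 1 + i) (by omega), Quaternion.re_zero, zero_smul,
        zero_sub, (commute_adjCoef B _).eq, ih, pow_succ' B, pow_succ']
      rcases neg_one_pow_eq_or (Matrix ι ι ℍ[ℝ]) i with h | h <;> rw [h] <;> simp [mul_assoc]
  have h2 : B ^ Fintype.card ι * adjCoef B (s + 1) = 0 := by
    have h := h1 (Fintype.card ι)
    rw [adjCoef_of_card_lt hB (by omega)] at h
    rcases neg_one_pow_eq_or (Matrix ι ι ℍ[ℝ]) (Fintype.card ι) with h' | h' <;>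
      rw [h'] at h <;> simpa [eq_comm] using h
  have h3 := mul_eq_zero_of_pow_mul hB _ _ h2
  rw [← (commute_adjCoef B _).eq, adjCoef, sub_mul, sub_eq_zero, smul_mul_assoc, one_mul] at h3
  exact h3.symm

/-- The orthogonal projection onto the range of `B`. -/
noncomputable def rangeProj (B : Matrix ι ι ℍ[ℝ]) (s : ℕ) : Matrix ι ι ℍ[ℝ] :=
  (minorSum s B).re⁻¹ • (adjCoef B s * B)

theorem re_minorSum_ne_zero (hB : Bᴴ = B) (hs : IsTopOrder B s) : (minorSum s B).re ≠ 0 := by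
  intro h
  apply hs.1
  rw [minorSum_eq_coe hB, h, Quaternion.coe_zero]

theorem rangeProj_mul (hB : Bᴴ = B) (hs : IsTopOrder B s) : rangeProj B s * B = B := by
  rw [rangeProj, smul_mul_assoc, adjCoef_top_mul hB hs, smul_smul,
    inv_mul_cancel₀ (re_minorSum_ne_zero hB hs), one_smul]

theorem commute_rangeProj : Commute (rangeProj B s) B :=
  ((commute_adjCoef B s).mul_left (Commute.refl B)).smul_left _

theorem conjTranspose_rangeProj (hB : Bᴴ = B) : (rangeProj B s)ᴴ = rangeProj B s := by
  rw [rangeProj, conjTranspose_real_smul, Matrix.conjTranspose_mul, hB, conjTranspose_adjCoef hB,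
    (commute_adjCoef B s).eq]

theorem rangeProj_mul_self (hB : Bᴴ = B) (hs : IsTopOrder B s) :
    rangeProj B s * rangeProj B s = rangeProj B s := by
  have h : rangeProj B s = (minorSum s B).re⁻¹ • (B * adjCoef B s) := by
    rw [rangeProj, (commute_adjCoef B s).eq]
  nth_rw 2 3 [h]
  rw [mul_smul_comm, ← mul_assoc, rangeProj_mul hB hs]

theorem reTrace_rangeProj (hB : Bᴴ = B) (hs : IsTopOrder B s) : reTrace (rangeProj B s) = s := by
  rw [rangeProj, reTrace_real_smul, (commute_adjCoef B s).eq, reTrace_mul_adjCoef hB, mul_comm,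
    mul_assoc, mul_inv_cancel₀ (re_minorSum_ne_zero hB hs), mul_one]

theorem conjTranspose_gram (A : Matrix ι κ ℍ[ℝ]) : (Aᴴ * A)ᴴ = Aᴴ * A := by
  rw [Matrix.conjTranspose_mul, Matrix.conjTranspose_conjTranspose]

theorem conjTranspose_gram' (A : Matrix ι κ ℍ[ℝ]) : (A * Aᴴ)ᴴ = A * Aᴴ := by
  rw [Matrix.conjTranspose_mul, Matrix.conjTranspose_conjTranspose]

theorem mul_rangeProj_gram (A : Matrix ι κ ℍ[ℝ]) (hs : IsTopOrder (Aᴴ * A) s) :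
    A * rangeProj (Aᴴ * A) s = A := by
  have hB := conjTranspose_gram A
  have h : A * (1 - rangeProj (Aᴴ * A) s) = 0 := by
    apply mul_eq_zero_of_conjTranspose_mul
    rw [mul_sub, mul_one, ← commute_rangeProj.eq, rangeProj_mul hB hs, sub_self]
  rw [Matrix.mul_sub, Matrix.mul_one, sub_eq_zero] at h
  exact h.symm

/-- The order of the last nonvanishing sum of principal minors of `Aᴴ A` is the rank of `A`. -/
theorem isTopOrder_gram (A : Matrix ι κ ℍ[ℝ]) : IsTopOrder (Aᴴ * A) (rk A) := by
  obtain ⟨s, hs⟩ := exists_isTopOrder (Aᴴ * A)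
  have hB := conjTranspose_gram A
  -- The projection and `A` are left multiples of each other, so their ranks agree; the trace
  -- identifies that rank as `s`.
  have h1 : rk A ≤ rk (rangeProj (Aᴴ * A) s) := rk_le_of_eq_mul A (mul_rangeProj_gram A hs).symm
  have h2 : rk (rangeProj (Aᴴ * A) s) ≤ rk A := by
    refine rk_le_of_eq_mul ((minorSum s (Aᴴ * A)).re⁻¹ • (adjCoef (Aᴴ * A) s * Aᴴ)) ?_
    rw [rangeProj, Matrix.smul_mul, Matrix.mul_assoc]
  have h3 := reTrace_of_idempotent (rangeProj_mul_self hB hs)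
  rw [reTrace_rangeProj hB hs, ← le_antisymm h1 h2] at h3
  rwa [← Nat.cast_injective h3]

theorem isTopOrder_gram' (A : Matrix ι κ ℍ[ℝ]) : IsTopOrder (A * Aᴴ) (rk A) := by
  have h := isTopOrder_gram A
  exact ⟨by rw [minorSum_mul_conjTranspose]; exact h.1,
    fun q hq => by rw [minorSum_mul_conjTranspose]; exact h.2 q hq⟩

/-! #### Determinantal representations of the Moore–Penrose inverse -/

theorem isMoorePenrose_mpInv (A : Matrix ι κ ℍ[ℝ]) : IsMoorePenrose A (mpInv A) :=
  (existsUnique_moorePenrose A).choose_spec.1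

theorem eq_mpInv {A : Matrix ι κ ℍ[ℝ]} {X : Matrix κ ι ℍ[ℝ]} (h : IsMoorePenrose A X) :
    X = mpInv A :=
  (existsUnique_moorePenrose A).choose_spec.2 X h

theorem mpInv_conjTranspose (A : Matrix ι κ ℍ[ℝ]) : mpInv Aᴴ = (mpInv A)ᴴ := by
  symm
  apply eq_mpInv
  obtain ⟨h1, h2, h3, h4⟩ := isMoorePenrose_mpInv A
  refine ⟨?_, ?_, ?_, ?_⟩
  · rw [← Matrix.conjTranspose_mul, ← Matrix.conjTranspose_mul, ← Matrix.mul_assoc, h1]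
  · rw [← Matrix.conjTranspose_mul, ← Matrix.conjTranspose_mul, ← Matrix.mul_assoc, h2]
  · rw [← Matrix.conjTranspose_mul, h4, h4]
  · rw [← Matrix.conjTranspose_mul, h3, h3]

/-- Put `X = d⁻¹ • (Aᴴ * C)`. Then `A * X` is the range projection of `A * Aᴴ`, which fixes `A`, and
`X * A` is Hermitian because `C` is; so `X` satisfies the Penrose equations. -/
theorem conjTranspose_mul_adjCoef (A : Matrix ι κ ℍ[ℝ]) (hs : IsTopOrder (A * Aᴴ) s) :
    Aᴴ * adjCoef (A * Aᴴ) s = (minorSum s (A * Aᴴ)).re • mpInv A := by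
  have hB := conjTranspose_gram' A
  have hd := re_minorSum_ne_zero hB hs
  set d := (minorSum s (A * Aᴴ)).re with hd_def
  set C := adjCoef (A * Aᴴ) s with hC
  set E := rangeProj (A * Aᴴ) s with hE
  have hEC : E = d⁻¹ • (A * Aᴴ * C) := by
    rw [hE, rangeProj, (commute_adjCoef (A * Aᴴ) s).eq]
  have hEA : E * A = A := by
    have hs' : IsTopOrder (Aᴴᴴ * Aᴴ) s := by rwa [Matrix.conjTranspose_conjTranspose]
    have h := congrArg Matrix.conjTranspose (mul_rangeProj_gram Aᴴ hs')
    rw [Matrix.conjTranspose_conjTranspose] at h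
    rwa [Matrix.conjTranspose_mul, Matrix.conjTranspose_conjTranspose,
      conjTranspose_rangeProj hB] at h
  have hAX : A * (d⁻¹ • (Aᴴ * C)) = E := by
    rw [Matrix.mul_smul, ← Matrix.mul_assoc, hEC]
  have hmp : IsMoorePenrose A (d⁻¹ • (Aᴴ * C)) := by
    refine ⟨by rw [hAX, hEA], ?_, by rw [hAX, conjTranspose_rangeProj hB], ?_⟩
    · have hcomm : C * E = E * C := by
        have h1 : Commute C (A * Aᴴ) := commute_adjCoef _ _
        exact (((Commute.refl C).mul_right h1).smul_right _).eq
      have hAE : Aᴴ * E = Aᴴ := by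
        have h := congrArg Matrix.conjTranspose hEA
        rwa [Matrix.conjTranspose_mul, conjTranspose_rangeProj hB] at h
      rw [Matrix.mul_assoc, hAX, Matrix.smul_mul, Matrix.mul_assoc, hcomm, ← Matrix.mul_assoc,
        hAE]
    · rw [Matrix.smul_mul, conjTranspose_real_smul, Matrix.conjTranspose_mul,
        Matrix.conjTranspose_mul, Matrix.conjTranspose_conjTranspose, conjTranspose_adjCoef hB,
        Matrix.mul_assoc]
  rw [← eq_mpInv hmp, smul_smul, mul_inv_cancel₀ hd, one_smul]

/-- Row representation of the Moore–Penrose inverse. -/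
theorem of_rdetSum_row {μ : Type*} (A : Matrix ι κ ℍ[ℝ]) (hs : IsTopOrder (A * Aᴴ) s)
    (Y : Matrix μ κ ℍ[ℝ]) :
    (Matrix.of fun i j => rdetSum s (A * Aᴴ) j ((Y * Aᴴ).row i)) =
      (minorSum s (A * Aᴴ)).re • (Y * mpInv A) := by
  rw [← Matrix.mul_smul, ← conjTranspose_mul_adjCoef A hs, ← Matrix.mul_assoc]
  ext1 i j
  rw [Matrix.of_apply, rdetSum_eq_vecMul (conjTranspose_gram' A)]
  rfl

theorem cdetSum_eq_star_rdetSum (q : ℕ) (B : Matrix ι ι ℍ[ℝ]) (i : ι) (c : ι → ℍ[ℝ]) :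
    cdetSum q B i c = star (rdetSum q Bᴴ i (star c)) := by
  unfold cdetSum rdetSum
  rw [star_sum]
  refine Finset.sum_congr rfl fun β _ => ?_
  rw [cdet_eq_star_rdet]
  congr 2
  ext1 x y
  simp only [principal, Matrix.conjTranspose_apply, Matrix.submatrix_apply, Matrix.updateCol_apply,
    Matrix.updateRow_apply, Pi.star_apply]
  split_ifs <;> rfl

/-- Column representation of the Moore–Penrose inverse. -/
theorem of_cdetSum_col {μ : Type*} (A : Matrix ι κ ℍ[ℝ]) (hs : IsTopOrder (Aᴴ * A) s)
    (Y : Matrix ι μ ℍ[ℝ]) :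
    (Matrix.of fun i j => cdetSum s (Aᴴ * A) i ((Aᴴ * Y).col j)) =
      (minorSum s (Aᴴ * A)).re • (mpInv A * Y) := by
  have hs' : IsTopOrder (Aᴴ * Aᴴᴴ) s := by rwa [Matrix.conjTranspose_conjTranspose]
  have h := congrArg Matrix.conjTranspose (of_rdetSum_row Aᴴ hs' Yᴴ)
  rw [conjTranspose_real_smul, Matrix.conjTranspose_mul, mpInv_conjTranspose,
    Matrix.conjTranspose_conjTranspose, Matrix.conjTranspose_conjTranspose,
    Matrix.conjTranspose_conjTranspose] at h
  rw [← h]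
  ext1 i j
  rw [Matrix.of_apply, cdetSum_eq_star_rdetSum, Matrix.conjTranspose_apply, Matrix.of_apply,
    conjTranspose_gram]
  congr 2
  ext1 x
  change star ((Aᴴ * Y) x j) = (Yᴴ * A) j x
  rw [← Matrix.conjTranspose_apply, Matrix.conjTranspose_mul, Matrix.conjTranspose_conjTranspose]

end TopMinors

/-! ### Drazin and weighted Drazin inverses through Moore–Penrose inverses. -/

section Drazin

variable {ι κ : Type*} [Fintype ι] [DecidableEq ι] [Fintype κ] [DecidableEq κ]

/-- `D` is the Drazin inverse of `U`. -/
def IsDrazin (U D : Matrix ι ι ℍ[ℝ]) : Prop :=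
  U ^ (ind U + 1) * D = U ^ ind U ∧ D * U * D = D ∧ U * D = D * U

variable {U D : Matrix ι ι ℍ[ℝ]} {k : ℕ}

theorem IsDrazin.pow_succ_mul (h : IsDrazin U D) (hk : ind U ≤ k) : U ^ (k + 1) * D = U ^ k := by
  obtain ⟨i, rfl⟩ := Nat.exists_eq_add_of_le hk
  rw [show ind U + i + 1 = i + (ind U + 1) by omega, pow_add, mul_assoc, h.1, ← pow_add, add_comm]

theorem IsDrazin.pow_eq (h : IsDrazin U D) (hk : ind U ≤ k) (i : ℕ) :
    U ^ k = U ^ (k + i) * D ^ i :=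
  pow_eq_pow_add (h.pow_succ_mul hk).symm i

theorem IsDrazin.pow_eq' (h : IsDrazin U D) (hk : ind U ≤ k) (i : ℕ) :
    U ^ k = D ^ i * U ^ (k + i) := by
  have hc : Commute U D := h.2.2
  rw [← (hc.pow_pow (k + i) i).eq, ← h.pow_eq hk]

theorem IsDrazin.eq_pow_mul (h : IsDrazin U D) (i : ℕ) : D = U ^ i * D ^ (i + 1) := by
  induction i with
  | zero => simp
  | succ i ih =>
    calc D = U * D * D := by rw [h.2.2]; exact h.2.1.symm
      _ = U * (U ^ i * D ^ (i + 1)) * D := by rw [← ih]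
      _ = U ^ (i + 1) * D ^ (i + 1 + 1) := by
        rw [pow_succ' U, pow_succ D (i + 1)]; simp only [mul_assoc]

theorem IsDrazin.rk_pow (h : IsDrazin U D) (hk : ind U ≤ k) : rk (U ^ (2 * k + 1)) = rk (U ^ k)
    := by
  apply le_antisymm
  · exact rk_le_of_eq_mul (U ^ (k + 1)) (by rw [← pow_add]; congr 1; omega)
  · refine rk_le_of_eq_mul (D ^ (k + 1)) ?_
    rw [show 2 * k + 1 = k + (k + 1) by omega]
    exact h.pow_eq' hk (k + 1)

/-- Both factors `U ^ k` are multiples of `U ^ (2 * k + 1)` by `D ^ (k + 1)`, one on each side. Only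
the first Penrose equation is then needed to remove the inverse. -/
theorem IsDrazin.eq_mpInv (h : IsDrazin U D) (hk : ind U ≤ k) :
    U ^ k * mpInv (U ^ (2 * k + 1)) * U ^ k = D := by
  have hmp := (existsUnique_moorePenrose (U ^ (2 * k + 1))).choose_spec.1.1
  change _ * mpInv (U ^ (2 * k + 1)) * _ = _ at hmp
  have h1 := h.pow_eq hk (k + 1)
  have h2 := h.pow_eq' hk (k + 1)
  rw [show k + (k + 1) = 2 * k + 1 by omega] at h1 h2
  calc U ^ k * mpInv (U ^ (2 * k + 1)) * U ^ k
      = D ^ (k + 1) * U ^ (2 * k + 1) * mpInv (U ^ (2 * k + 1)) *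
        (U ^ (2 * k + 1) * D ^ (k + 1)) := by rw [← h1, ← h2]
    _ = D ^ (k + 1) * (U ^ (2 * k + 1) * mpInv (U ^ (2 * k + 1)) * U ^ (2 * k + 1)) *
        D ^ (k + 1) := by simp only [mul_assoc]
    _ = U ^ k * D ^ (k + 1) := by rw [hmp, ← h2]
    _ = D := (h.eq_pow_mul k).symm

theorem wDrazin_eq_left (A : Matrix ι κ ℍ[ℝ]) (W : Matrix κ ι ℍ[ℝ]) {D : Matrix ι ι ℍ[ℝ]}
    (h : IsDrazin (A * W) D) : wDrazin A W = D * D * A := by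
  symm
  apply (existsUnique_wDrazin A W).choose_spec.2
  obtain ⟨d1, d2, d3⟩ := h
  have hW : D * D * A * W = D := by
    rw [Matrix.mul_assoc, mul_assoc, ← d3, ← mul_assoc, d2]
  have hL : A * W * (D * D * A) = D * A := by
    rw [← Matrix.mul_assoc, ← mul_assoc, d3, d2]
  refine ⟨?_, ?_, ?_⟩
  · rw [Matrix.mul_assoc, hW, d1]
  · rw [hW, Matrix.mul_assoc D A W, Matrix.mul_assoc, hL, ← Matrix.mul_assoc]
  · rw [hL, hW]

/-- The relation `V ^ i * A = A * U ^ i` carries high powers across `A`, so the squares of the two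
Drazin inverses, written with such powers, can be exchanged. -/
theorem wDrazin_eq_right (A : Matrix ι κ ℍ[ℝ]) (W : Matrix κ ι ℍ[ℝ]) {D : Matrix κ κ ℍ[ℝ]}
    (h : IsDrazin (W * A) D) : wDrazin A W = A * (D * D) := by
  obtain ⟨D', h'⟩ := exists_drazin (A * W)
  change IsDrazin (A * W) D' at h'
  rw [wDrazin_eq_left A W h']
  set U := W * A with hU
  set V := A * W with hV
  have hint : ∀ i : ℕ, V ^ i * A = A * U ^ i := by
    intro i
    induction i with
    | zero => simp
    | succ i ih =>
      calc V ^ (i + 1) * A = V ^ i * A * (W * A) := by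
            rw [pow_succ, hV]; simp only [Matrix.mul_assoc]
        _ = A * U ^ (i + 1) := by rw [ih, ← hU, Matrix.mul_assoc, ← pow_succ]
  obtain ⟨k, hkU, hkV⟩ : ∃ k, ind U ≤ k ∧ ind V ≤ k := ⟨_, le_max_left _ _, le_max_right _ _⟩
  have hU2 := h.pow_eq hkU (k + 2)
  have hV2 := h'.pow_eq' hkV (k + 2)
  have hDU : D * D = U ^ k * D ^ (k + 2) := by
    have := congrArg (· * D) (h.eq_pow_mul k)
    simpa only [mul_assoc, ← pow_succ] using this
  have hDV : D' * D' = D' ^ (k + 2) * V ^ k := by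
    have hc : Commute V D' := h'.2.2
    have h1 := congrArg (· * D') (h'.eq_pow_mul k)
    simp only [mul_assoc, ← pow_succ] at h1
    rw [h1, (hc.pow_pow k (k + 2)).eq]
  calc D' * D' * A = D' ^ (k + 2) * (V ^ k * A) := by rw [hDV, Matrix.mul_assoc]
    _ = D' ^ (k + 2) * (A * U ^ (k + (k + 2))) * D ^ (k + 2) := by
      rw [hint, hU2]; simp only [Matrix.mul_assoc]
    _ = D' ^ (k + 2) * V ^ (k + (k + 2)) * A * D ^ (k + 2) := by
      rw [← hint]; simp only [Matrix.mul_assoc]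
    _ = A * (D * D) := by rw [← hV2, hint, Matrix.mul_assoc, ← hDU]

end Drazin

/-! ### Assembly of the two representations. -/

section Main

theorem eq_smul_div_coe_sq (x : ℍ[ℝ]) {a b c : ℝ} (ha : a ≠ 0) (hb : b ≠ 0) (hc
    : c = a ^ 2 * b ^ 2) :
    x = (c • x) / ((a : ℍ[ℝ]) ^ 2 * (b : ℍ[ℝ]) ^ 2) := by
  have h : ((a : ℍ[ℝ]) ^ 2 * (b : ℍ[ℝ]) ^ 2) = ((c : ℝ) : ℍ[ℝ]) := by
    rw [hc]; push_cast; rfl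
  have h0 : (c : ℍ[ℝ]) ≠ 0 := by
    rw [← Quaternion.coe_zero]
    exact fun h => (by rw [hc]; positivity : c ≠ 0) (Quaternion.coe_injective h)
  rw [h, eq_div_iff h0, Quaternion.mul_coe_eq_smul]

end Main

end QuatMat
open QuatMat
theorem theorem5p3 (m n : ℕ) (A : Matrix (Fin m) (Fin n) ℍ[ℝ]) (W : Matrix (Fin n) (Fin m) ℍ[ℝ])
    (hW : W ≠ 0) (r r₁ k : ℕ) (hr : rk A = r) (hk : k = max (ind (W * A)) (ind (A * W))) :
    (rk ((W * A) ^ k) = r₁ →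
      let U : Matrix (Fin n) (Fin n) ℍ[ℝ] := W * A
      let G : Matrix (Fin n) (Fin n) ℍ[ℝ] := U ^ (2 * k + 1) * (U ^ (2 * k + 1))ᴴ
      let Uc : Matrix (Fin n) (Fin n) ℍ[ℝ] := U ^ k * (U ^ (2 * k + 1))ᴴ
      let Φ : Matrix (Fin n) (Fin n) ℍ[ℝ] := Matrix.of fun l q => rdetSum r₁ G q (Uc.row l)
      let Φt : Matrix (Fin m) (Fin n) ℍ[ℝ] := A * Φ * U ^ (2 * k) * (U ^ (2 * k + 1))ᴴ
      let Φh : Matrix (Fin m) (Fin n) ℍ[ℝ] := Matrix.of fun t z => rdetSum r₁ G z (Φt.row t)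
      let Φ₁ : Matrix (Fin n) (Fin n) ℍ[ℝ] := Aᴴ * A * W * Φh
      let Ω : Matrix (Fin n) (Fin n) ℍ[ℝ] := Matrix.of fun i z => cdetSum r (Aᴴ * A) i (Φ₁.col z)
      let Ωt : Matrix (Fin n) (Fin m) ℍ[ℝ] := Ω * (W * A) ^ (k + 1) * Aᴴ
      ∀ (i : Fin n) (j : Fin m),
        wCMP A W i j = rdetSum r (A * Aᴴ) j (Ωt.row i) /
          ((minorSum r (Aᴴ * A)) ^ 2 * (minorSum r₁ G) ^ 2)) ∧
    (rk ((A * W) ^ k) = r₁ →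
      let V : Matrix (Fin m) (Fin m) ℍ[ℝ] := A * W
      let H : Matrix (Fin m) (Fin m) ℍ[ℝ] := (V ^ (2 * k + 1))ᴴ * V ^ (2 * k + 1)
      let Vh : Matrix (Fin m) (Fin m) ℍ[ℝ] := (V ^ (2 * k + 1))ᴴ * V ^ k
      let Ψ : Matrix (Fin m) (Fin m) ℍ[ℝ] := Matrix.of fun l t => cdetSum r₁ H l (Vh.col t)
      let Ψt : Matrix (Fin m) (Fin n) ℍ[ℝ] := (V ^ (2 * k + 1))ᴴ * V ^ (2 * k) * Ψ * A
      let Ψh : Matrix (Fin m) (Fin n) ℍ[ℝ] := Matrix.of fun z s => cdetSum r₁ H z (Ψt.col s)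
      let Ψ₁ : Matrix (Fin m) (Fin m) ℍ[ℝ] := Ψh * W * A * Aᴴ
      let Υ : Matrix (Fin m) (Fin m) ℍ[ℝ] := Matrix.of fun z j => rdetSum r (A * Aᴴ) j (Ψ₁.row z)
      let Υt : Matrix (Fin n) (Fin m) ℍ[ℝ] := Aᴴ * (A * W) ^ (k + 1) * Υ
      ∀ (i : Fin n) (j : Fin m),
        wCMP A W i j = cdetSum r (Aᴴ * A) i (Υt.col j) /
          ((minorSum r (A * Aᴴ)) ^ 2 * (minorSum r₁ H) ^ 2)) := by
  have hBA := conjTranspose_gram A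
  have hBA' := conjTranspose_gram' A
  have htop : IsTopOrder (Aᴴ * A) r := hr ▸ isTopOrder_gram A
  have htop' : IsTopOrder (A * Aᴴ) r := hr ▸ isTopOrder_gram' A
  have hdeq : minorSum r (A * Aᴴ) = minorSum r (Aᴴ * A) := minorSum_mul_conjTranspose A r
  refine ⟨?_, ?_⟩
  · intro hr₁ U G Uc Φ Φt Φh Φ₁ Ω Ωt i j
    obtain ⟨D, hD⟩ := exists_drazin U
    change IsDrazin U D at hD
    have hkU : ind U ≤ k := hk ▸ le_max_left _ _
    have hrM : rk (U ^ (2 * k + 1)) = r₁ := (hD.rk_pow hkU).trans hr₁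
    have hG : IsTopOrder G r₁ := hrM ▸ isTopOrder_gram' (U ^ (2 * k + 1))
    have hMP := hD.eq_mpInv hkU
    set P := mpInv (U ^ (2 * k + 1)) with hP
    set e := (minorSum r₁ G).re with he
    set d := (minorSum r (Aᴴ * A)).re with hd
    have hΦ : Φ = e • (U ^ k * P) := of_rdetSum_row (U ^ (2 * k + 1)) hG (U ^ k)
    have hΦh : Φh = e • (A * Φ * U ^ (2 * k) * P) :=
      of_rdetSum_row (U ^ (2 * k + 1)) hG (A * Φ * U ^ (2 * k))
    have hΦ₁ : Φ₁ = Aᴴ * (A * W * Φh) := by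
      simp only [Φ₁, Matrix.mul_assoc]
    have hΩ : Ω = d • (mpInv A * (A * W * Φh)) := by
      simp only [Ω]
      rw [hΦ₁]
      exact of_cdetSum_col A htop (A * W * Φh)
    have hrow : rdetSum r (A * Aᴴ) j (Ωt.row i) =
        (minorSum r (A * Aᴴ)).re • (Ω * (W * A) ^ (k + 1) * mpInv A) i j :=
      congrFun (congrFun (of_rdetSum_row A htop' (Ω * (W * A) ^ (k + 1))) i) j
    have hΩU : Ω * (W * A) ^ (k + 1) * mpInv A = (d * e * e) • wCMP A W := by
      change Ω * U ^ (k + 1) * mpInv A = _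
      -- Splitting `U ^ (2 * k)` in the middle forms two blocks `U ^ k * P * U ^ k`, each equal to
      -- `D`, with one factor `U` left over.
      have hkey : U ^ k * P * U ^ (2 * k) * P * U ^ (k + 1) = D * D * U := by
        rw [← hMP, two_mul, pow_add, pow_succ]
        simp only [mul_assoc]
      rw [wCMP, wDrazin_eq_right A W hD, hΩ, hΦh, hΦ]
      simp only [Matrix.mul_smul, Matrix.smul_mul, smul_smul]
      rw [← mul_assoc d e e]
      congr 1
      calc mpInv A * (A * W * (A * (U ^ k * P) * U ^ (2 * k) * P)) * U ^ (k + 1) * mpInv A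
          = mpInv A * (A * W * A * (U ^ k * P * U ^ (2 * k) * P * U ^ (k + 1))) * mpInv A := by
            simp only [Matrix.mul_assoc]
        _ = mpInv A * (A * W * A * (D * D * (W * A))) * mpInv A := by rw [hkey]
        _ = mpInv A * A * W * (A * (D * D)) * W * A * mpInv A := by
            simp only [Matrix.mul_assoc]
    rw [hrow, hΩU, hdeq, Matrix.smul_apply, smul_smul, minorSum_eq_coe hBA,
      minorSum_eq_coe (conjTranspose_gram' (U ^ (2 * k + 1)))]
    refine eq_smul_div_coe_sq _ (re_minorSum_ne_zero hBA htop)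
      (re_minorSum_ne_zero (conjTranspose_gram' (U ^ (2 * k + 1))) hG) ?_
    rw [Quaternion.re_coe]
    ring
  · intro hr₁ V H Vh Ψ Ψt Ψh Ψ₁ Υ Υt i j
    obtain ⟨D, hD⟩ := exists_drazin V
    change IsDrazin V D at hD
    have hkV : ind V ≤ k := hk ▸ le_max_right _ _
    have hrM : rk (V ^ (2 * k + 1)) = r₁ := (hD.rk_pow hkV).trans hr₁
    have hH : IsTopOrder H r₁ := hrM ▸ isTopOrder_gram (V ^ (2 * k + 1))
    have hMP := hD.eq_mpInv hkV
    set P := mpInv (V ^ (2 * k + 1)) with hP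
    set e := (minorSum r₁ H).re with he
    set d := (minorSum r (A * Aᴴ)).re with hd
    have hΨ : Ψ = e • (P * V ^ k) := of_cdetSum_col (V ^ (2 * k + 1)) hH (V ^ k)
    have hΨt : Ψt = (V ^ (2 * k + 1))ᴴ * (V ^ (2 * k) * Ψ * A) := by
      simp only [Ψt, Matrix.mul_assoc]
    have hΨh : Ψh = e • (P * (V ^ (2 * k) * Ψ * A)) := by
      simp only [Ψh]
      rw [hΨt]
      exact of_cdetSum_col (V ^ (2 * k + 1)) hH (V ^ (2 * k) * Ψ * A)
    have hΥ : Υ = d • (Ψh * W * A * mpInv A) := of_rdetSum_row A htop' (Ψh * W * A)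
    have hΥt : Υt = Aᴴ * ((A * W) ^ (k + 1) * Υ) := by
      simp only [Υt, Matrix.mul_assoc]
    have hcol : cdetSum r (Aᴴ * A) i (Υt.col j) =
        (minorSum r (Aᴴ * A)).re • (mpInv A * ((A * W) ^ (k + 1) * Υ)) i j := by
      rw [hΥt]
      exact congrFun (congrFun (of_cdetSum_col A htop ((A * W) ^ (k + 1) * Υ)) i) j
    have hΥV : mpInv A * ((A * W) ^ (k + 1) * Υ) = (d * e * e) • wCMP A W := by
      change mpInv A * (V ^ (k + 1) * Υ) = _
      -- The same splitting as for `U`, with the surplus factor `V` now on the left.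
      have hkey : V ^ (k + 1) * P * V ^ (2 * k) * P * V ^ k = V * (D * D) := by
        rw [← hMP, two_mul, pow_add V k k, pow_succ']
        simp only [mul_assoc]
      rw [wCMP, wDrazin_eq_left A W hD, hΥ, hΨh, hΨ]
      simp only [Matrix.mul_smul, Matrix.smul_mul, smul_smul]
      rw [← mul_assoc d e e]
      congr 1
      calc mpInv A * (V ^ (k + 1) * (P * (V ^ (2 * k) * (P * V ^ k) * A) * W * A * mpInv A))
          = mpInv A * (V ^ (k + 1) * P * V ^ (2 * k) * P * V ^ k * (A * W * A)) * mpInv A := by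
            simp only [Matrix.mul_assoc]
        _ = mpInv A * (A * W * (D * D) * (A * W * A)) * mpInv A := by rw [hkey]
        _ = mpInv A * A * W * (D * D * A) * W * A * mpInv A := by
            simp only [Matrix.mul_assoc]
    rw [hcol, hΥV, ← hdeq, Matrix.smul_apply, smul_smul, minorSum_eq_coe hBA',
      minorSum_eq_coe (conjTranspose_gram (V ^ (2 * k + 1)))]
    refine eq_smul_div_coe_sq _ (re_minorSum_ne_zero hBA' htop')
      (re_minorSum_ne_zero (conjTranspose_gram (V ^ (2 * k + 1))) hH) ?_
    rw [Quaternion.re_coe]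
    ring
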